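/- Let $1\le k<n$, $q\ge 1$, let $X\in\mathbb R^{n\times k}$ have rank $k$ with rows $x_{1\cdot},\dots,x_{n\cdot}$, let $R\in\mathbb R^{q\times k}$ have rank $q$, and let $r\in\mathbb R^q$. Put $\mathfrak M=\operatorname{span}(X)$ (column space), $\mathfrak M_0=\{X\beta: R\beta=r\}$, $\mathfrak M_1=\mathfrak M\setminus\mathfrak M_0$. For $-1<\rho<1$ let $\Lambda(\rho)=(\rho^{|i-j|})_{i,j=1}^n$, and let $P_{\mu,\sigma^2\Lambda(\rho)}$ be the Gaussian law on $\mathbb R^n$ with mean $\mu$ and covariance matrix $\sigma^2\Lambda(\rho)$, where $0<\sigma<\infty$. Let $e_+=(1,\dots,1)'$, $e_-=(-1,1,\dots,(-1)^n)'$, let $e_i(n)$ be the $i$-th standard basis vector of $\mathbb R^n$, and let $d$ be the Euclidean distance. Let $w(j)$, $|j|\le n-1$, be real weights with $w(0)=1$ and $w(-j)=w(j)$ such that the $n\times n$ Toeplitz matrix $(w(i-j))_{i,j}$ is positive definite. For $y\in\mathbb R^n$ let $\hat\beta(y)=(X'X)^{-1}X'y$, $\hat u(y)=y-X\hat\beta(y)$,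 $\hat v_t(y)=\hat u_t(y)x_{t\cdot}'$, $\hat\Gamma_j(y)=n^{-1}\sum_{t=j+1}^n\hat v_t(y)\hat v_{t-j}(y)'$ for $j\ge 0$ and $\hat\Gamma_j(y)=\hat\Gamma_{-j}(y)'$ for $j<0$, and put $$\hat\Psi_w(y)=\sum_{j=-(n-1)}^{n-1}w(j)\hat\Gamma_j(y),\qquad \hat\Omega_w(y)=nR(X'X)^{-1}\hat\Psi_w(y)(X'X)^{-1}R'.$$ Define the test statistic $T(y)=(R\hat\beta(y)-r)'\hat\Omega_w(y)^{-1}(R\hat\beta(y)-r)$ if $\det\hat\Omega_w(y)\ne0$ and $T(y)=0$ otherwise, and for $0<C<\infty$ the rejection region $W(C)=\{y: T(y)\ge C\}$. Assume that the matrix obtained from $R(X'X)^{-1}X'$ by deleting every column whose index $i$ satisfies $e_i(n)\in\mathfrak M$ has rank $q$. Suppose $e_+,e_-\in\mathfrak M$ and $R\hat\beta(e_+)=R\hat\beta(e_-)=0$. Then, for every $0<C<\infty$: 1. $\displaystyle\sup_{\mu_0\in\mathfrak M_0}\sup_{0<\sigma^2<\infty}\sup_{-1<\rho<1}P_{\mu_0,\sigma^2\Lambda(\rho)}(W(C))<1$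 and $\displaystyle\inf_{\mu_0\in\mathfrak M_0}\inf_{0<\sigma^2<\infty}\inf_{-1<\rho<1}P_{\mu_0,\sigma^2\Lambda(\rho)}(W(C))>0$. 2. $\displaystyle\inf_{\mu_1\in\mathfrak M_1}\inf_{0<\sigma^2<\infty}\inf_{-1<\rho<1}P_{\mu_1,\sigma^2\Lambda(\rho)}(W(C))>0$. 3. For every $0<c<\infty$ and every sequence $\rho_m\in(-1,1)$ with $|\rho_m|\to1$, $$\inf_{\substack{\mu_1\in\mathfrak M_1,\;0<\sigma^2<\infty\\ d(\mu_1,\mathfrak M_0)/\sigma\ge c}}P_{\mu_1,\sigma^2\Lambda(\rho_m)}(W(C))\to1\qquad(m\to\infty).$$ Furthermore, for every $0<\varepsilon<1$ and all sequences $0<c_m<\infty$, $0<\sigma_m<\infty$ with $c_m/\sigma_m\to\infty$, $$\inf_{\substack{\mu_1\in\mathfrak M_1\\ d(\mu_1,\mathfrak M_0)\ge c_m}}\ \inf_{-1+\varepsilon\le\rho\le1-\varepsilon}P_{\mu_1,\sigma_m^2\Lambda(\rho)}(W(C))\to1\qquad(m\to\infty);$$ this last statement holds even without the conditions $e_+,e_-\in\mathfrak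 M$ and $R\hat\beta(e_+)=R\hat\beta(e_-)=0$. 4. Moreover, for every $0<\delta<1$ there is a $C(\delta)\in(0,\infty)$ such that $\displaystyle\sup_{\mu_0\in\mathfrak M_0}\sup_{0<\sigma^2<\infty}\sup_{-1<\rho<1}P_{\mu_0,\sigma^2\Lambda(\rho)}(W(C(\delta)))\le\delta$. -/

import Mathlib

open MeasureTheory ProbabilityTheory Filter Topology Matrix
open scoped ENNReal

noncomputable section

namespace HACTest

/-- The AR(1) correlation matrix with entries `ρ ^ |i - j|`. -/
def ar1Corr (n : ℕ) (ρ : ℝ) : Matrix (Fin n) (Fin n) ℝ :=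
  Matrix.of fun i j => ρ ^ ((i : ℤ) - (j : ℤ)).natAbs

/-- The vector `(1, …, 1)'`. -/
def ePlus (n : ℕ) : EuclideanSpace ℝ (Fin n) := WithLp.toLp 2 fun _ => 1

/-- The vector `(-1, 1, …, (-1)^n)'`; positions are counted from `0` here, so the entry at
position `i` is `(-1)^(i+1)`. -/
def eMinus (n : ℕ) : EuclideanSpace ℝ (Fin n) := WithLp.toLp 2 fun i => (-1) ^ ((i : ℕ) + 1)

variable {n k q : ℕ}

/-- The Gaussian law on `ℝⁿ` with mean `μ` and covariance matrix `σ² Λ(ρ)`. -/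
def ar1Law (μ : EuclideanSpace ℝ (Fin n)) (σ ρ : ℝ) : Measure (EuclideanSpace ℝ (Fin n)) :=
  multivariateGaussian μ (σ ^ 2 • ar1Corr n ρ)

/-- The column space of the design matrix. -/
def meanSpace (X : Matrix (Fin n) (Fin k) ℝ) : Set (EuclideanSpace ℝ (Fin n)) :=
  {μ | ∃ β : Fin k → ℝ, μ = WithLp.toLp 2 (X *ᵥ β)}

/-- The means `X β` with `R β = r`. -/
def nullMeans (X : Matrix (Fin n) (Fin k) ℝ) (R : Matrix (Fin q) (Fin k) ℝ) (r : Fin q → ℝ) :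
    Set (EuclideanSpace ℝ (Fin n)) :=
  {μ | ∃ β : Fin k → ℝ, μ = WithLp.toLp 2 (X *ᵥ β) ∧ R *ᵥ β = r}

/-- The means in the column space that do not belong to the null hypothesis. -/
def altMeans (X : Matrix (Fin n) (Fin k) ℝ) (R : Matrix (Fin q) (Fin k) ℝ) (r : Fin q → ℝ) :
    Set (EuclideanSpace ℝ (Fin n)) :=
  meanSpace X \ nullMeans X R r

/-- The ordinary least squares estimator `(X'X)⁻¹ X' y`. -/
def betaHat (X : Matrix (Fin n) (Fin k) ℝ) (y : EuclideanSpace ℝ (Fin n)) : Fin k → ℝ :=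
  (Xᵀ * X)⁻¹ *ᵥ (Xᵀ *ᵥ y.ofLp)

/-- The least squares residuals `y - X β̂(y)`. -/
def residual (X : Matrix (Fin n) (Fin k) ℝ) (y : EuclideanSpace ℝ (Fin n)) : Fin n → ℝ :=
  y.ofLp - X *ᵥ betaHat X y

/-- The vector `v̂_t(y) = û_t(y) x_t'`, where `x_t` is the `t`-th row of `X`. -/
def score (X : Matrix (Fin n) (Fin k) ℝ) (y : EuclideanSpace ℝ (Fin n)) (t : Fin n) :
    Fin k → ℝ :=
  residual X y t • X t

/-- The sample autocovariance `n⁻¹ ∑_{t=j+1}^n v̂_t v̂_{t-j}'` at a lag `j ≥ 0`. -/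
def autocovNat (X : Matrix (Fin n) (Fin k) ℝ) (y : EuclideanSpace ℝ (Fin n)) (j : ℕ) :
    Matrix (Fin k) (Fin k) ℝ :=
  (n : ℝ)⁻¹ • ∑ t : Fin n, ∑ s : Fin n,
    if (t : ℕ) = (s : ℕ) + j then vecMulVec (score X y t) (score X y s) else 0

/-- The sample autocovariance at an integer lag, with `Γ̂_j = Γ̂_{-j}'` for `j < 0`. -/
def autocov (X : Matrix (Fin n) (Fin k) ℝ) (y : EuclideanSpace ℝ (Fin n)) (j : ℤ) :
    Matrix (Fin k) (Fin k) ℝ :=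
  if 0 ≤ j then autocovNat X y j.toNat else (autocovNat X y (-j).toNat)ᵀ

/-- The weighted sum `∑_{|j| ≤ n-1} w(j) Γ̂_j(y)`. -/
def psiHat (w : ℤ → ℝ) (X : Matrix (Fin n) (Fin k) ℝ) (y : EuclideanSpace ℝ (Fin n)) :
    Matrix (Fin k) (Fin k) ℝ :=
  ∑ j ∈ Finset.Icc (-((n : ℤ) - 1)) ((n : ℤ) - 1), w j • autocov X y j

/-- `Ω̂_w(y) = n R (X'X)⁻¹ Ψ̂_w(y) (X'X)⁻¹ R'`. -/
def omegaHat (w : ℤ → ℝ) (X : Matrix (Fin n) (Fin k) ℝ) (R : Matrix (Fin q) (Fin k) ℝ)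
    (y : EuclideanSpace ℝ (Fin n)) : Matrix (Fin q) (Fin q) ℝ :=
  (n : ℝ) • (R * (Xᵀ * X)⁻¹ * psiHat w X y * (Xᵀ * X)⁻¹ * Rᵀ)

open Classical in
/-- The test statistic, set to `0` where `Ω̂_w(y)` is singular. -/
def testStat (w : ℤ → ℝ) (X : Matrix (Fin n) (Fin k) ℝ) (R : Matrix (Fin q) (Fin k) ℝ)
    (r : Fin q → ℝ) (y : EuclideanSpace ℝ (Fin n)) : ℝ :=
  if (omegaHat w X R y).det ≠ 0 then
    (R *ᵥ betaHat X y - r) ⬝ᵥ ((omegaHat w X R y)⁻¹ *ᵥ (R *ᵥ betaHat X y - r))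
  else 0

/-- The rejection region `{y | T(y) ≥ C}`. -/
def rejRegion (w : ℤ → ℝ) (X : Matrix (Fin n) (Fin k) ℝ) (R : Matrix (Fin q) (Fin k) ℝ)
    (r : Fin q → ℝ) (C : ℝ) : Set (EuclideanSpace ℝ (Fin n)) :=
  {y | C ≤ testStat w X R r y}

/-- The condition on the weights `w(j)`, `|j| ≤ n-1`: they are normalized and symmetric, and the
Toeplitz matrix `(w(i-j))` is positive definite. -/
structure AdmissibleWeights (n : ℕ) (w : ℤ → ℝ) : Prop where
  zero : w 0 = 1
  symm : ∀ j : ℤ, |j| ≤ (n : ℤ) - 1 → w (-j) = w j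
  posDef : (Matrix.of fun i j : Fin n => w ((i : ℤ) - (j : ℤ))).PosDef

open Classical in
/-- The matrix `R (X'X)⁻¹ X'(¬I)` has full row rank, where `X'(¬I)` is obtained from `X'` by
deleting all columns whose index `i` satisfies `e_i ∈ span(X)`. -/
def DesignCondition (X : Matrix (Fin n) (Fin k) ℝ) (R : Matrix (Fin q) (Fin k) ℝ) : Prop :=
  (R * (Xᵀ * X)⁻¹ * Xᵀ.submatrix id
    (Subtype.val : {i : Fin n // EuclideanSpace.single i (1 : ℝ) ∉ meanSpace X} → Fin n)).rank = q

end HACTest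

end

namespace HACTest

/-! ### Standard Gaussian measure and its linear images. -/

section Gaussian

/-! The law of the observations is the image of a standard Gaussian vector `z` under `μ + σ A z`,
with `A` a triangular root of the AR(1) correlation matrix. The difficulty is uniformity as `|ρ| →
1`, where `A` collapses to rank one with range spanned by `(τ ^ t)`, `τ = ±1`, that is, by `e₊` or
`e₋`.

Put `s = √(1 - ρ²)`. Then `A = s G + (1 - s) (τ ^ t) ⊗ e₀`, where `G` (`shockMatrix`) is continuous
and invertible up to and including `|ρ| = 1`. Shifting the data within the column space leaves the
covariance estimator unchanged, and shifting along `e₊`, `e₋` also leaves `R β̂` unchanged by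
assumption. Hence the rank-one term drops out, and the factor `σ s` is absorbed by rescaling: the
rejection probability equals that of the test of `R β = r'` at `G z`, with `r' = (σ s)⁻¹ (r - R β)`
(`exists_ar1Law_rejRegion_eq_shock`).

Everything then concerns a compact set of invertible operators `G`. Under the null `r' = 0`. Uniform
lower bounds for the probability of nonempty open sets keep the null rejection probability away from
0 and 1, and uniform continuity from below gives critical values of any size. Positive power follows
from the symmetry `z ↦ -z` and the parallelogram identity, at the cost of a factor 2. Power tends to
one because `‖r'‖ → ∞` uniformly, whether through `s → 0` or through distance over `σ`; in the
latter case `ρ` stays away from `±1`, so `A` itself ranges over a compact set of invertible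
operators and `e₊`, `e₋` play no role. -/

theorem isOpenPosMeasure_gaussianReal : (gaussianReal 0 1).IsOpenPosMeasure :=
  (gaussianReal_absolutelyContinuous' 0 one_ne_zero).isOpenPosMeasure

variable {n : ℕ}

instance isOpenPosMeasure_stdGaussian :
    (stdGaussian (EuclideanSpace ℝ (Fin n))).IsOpenPosMeasure := by
  have := isOpenPosMeasure_gaussianReal
  rw [← map_pi_eq_stdGaussian]
  exact (PiLp.continuous_toLp 2 _).isOpenPosMeasure_map (WithLp.toLp_surjective 2)

/-- The image of the measure under `L` is Gaussian with variance `‖L‖² > 0`, so it has no atoms. -/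
theorem stdGaussian_ker_eq_zero (L : StrongDual ℝ (EuclideanSpace ℝ (Fin n))) (hL : L ≠ 0) :
    stdGaussian (EuclideanSpace ℝ (Fin n)) {z | L z = 0} = 0 := by
  have h := IsGaussian.map_eq_gaussianReal (μ := stdGaussian (EuclideanSpace ℝ (Fin n))) L
  have h1 : stdGaussian (EuclideanSpace ℝ (Fin n)) {z | L z = 0}
      = (stdGaussian (EuclideanSpace ℝ (Fin n))).map L {0} := by
    rw [Measure.map_apply L.measurable (measurableSet_singleton 0)]
    rfl
  have h2 : (‖L‖ ^ 2).toNNReal ≠ 0 := by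
    rw [Ne, Real.toNNReal_eq_zero, not_le]
    have := norm_pos_iff.2 hL
    positivity
  rw [variance_dual_stdGaussian] at h
  rw [h1, h]
  have := nullSingletonClass_gaussianReal (μ := (stdGaussian (EuclideanSpace ℝ (Fin n)))[L]) h2
  exact measure_singleton 0

theorem stdGaussian_map_neg :
    (stdGaussian (EuclideanSpace ℝ (Fin n))).map (fun z => -z)
      = stdGaussian (EuclideanSpace ℝ (Fin n)) :=
  stdGaussian_map (LinearIsometryEquiv.neg ℝ)

/-- Any factor `L` of the covariance serves, not only the symmetric square root: the characteristic
functions agree because `‖Lᵀ x‖² = x' L Lᵀ x`. -/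
theorem multivariateGaussian_mul_transpose (μ : EuclideanSpace ℝ (Fin n))
    (L : Matrix (Fin n) (Fin n) ℝ) :
    multivariateGaussian μ (L * Lᵀ)
      = (stdGaussian (EuclideanSpace ℝ (Fin n))).map
          (fun z => μ + toEuclideanCLM (𝕜 := ℝ) L z) := by
  have hS : (L * Lᵀ).PosSemidef := by
    simpa [conjTranspose_eq_transpose_of_trivial] using posSemidef_self_mul_conjTranspose L
  have hc : (fun z => μ + toEuclideanCLM (𝕜 := ℝ) L z)
      = (fun z => μ + z) ∘ (toEuclideanCLM (𝕜 := ℝ) L) := rfl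
  apply Measure.ext_of_charFun
  ext x
  rw [charFun_multivariateGaussian hS, hc, ← Measure.map_map (by fun_prop) (by fun_prop),
    charFun_map_const_add]
  have h1 : charFun ((stdGaussian (EuclideanSpace ℝ (Fin n))).map (toEuclideanCLM (𝕜 := ℝ) L)) x
      = charFun (stdGaussian (EuclideanSpace ℝ (Fin n))) (toEuclideanCLM (𝕜 := ℝ) Lᵀ x) := by
    rw [charFun_apply, charFun_apply, integral_map (by fun_prop) (by fun_prop)]
    congr with z
    congr 3
    rw [EuclideanSpace.inner_eq_star_dotProduct, EuclideanSpace.inner_eq_star_dotProduct,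
      star_trivial, star_trivial, ofLp_toEuclideanCLM, ofLp_toEuclideanCLM, mulVec_transpose,
      dotProduct_mulVec]
  have h2 : ‖toEuclideanCLM (𝕜 := ℝ) Lᵀ x‖ ^ 2 = x.ofLp ⬝ᵥ (L * Lᵀ) *ᵥ x.ofLp := by
    rw [← real_inner_self_eq_norm_sq, EuclideanSpace.inner_eq_star_dotProduct, star_trivial,
      ofLp_toEuclideanCLM, mulVec_transpose, ← mulVec_mulVec,
      mulVec_transpose, dotProduct_mulVec]
  rw [h1, charFun_stdGaussian, ← Complex.ofReal_pow, h2, ← Complex.exp_add, real_inner_comm]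
  congr 1
  ring

end Gaussian

/-! ### Uniform bounds over compact sets of operators. -/

section Compactness

variable {E : Type*} [NormedAddCommGroup E] [NormedSpace ℝ E] [MeasurableSpace E]

/-- Lower semicontinuity of `G ↦ γ (G ⁻¹' U)`: by inner regularity a compact part of the preimage
already has mass above `c`, and operators close to `G` still send it into `U`. -/
theorem eventually_lt_measure_preimage {γ : Measure E} [γ.Regular] {U : Set E} (hU : IsOpen U)
    {c : ℝ≥0∞} {G : E →L[ℝ] E} (hc : c < γ (G ⁻¹' U)) :
    ∀ᶠ G' : E →L[ℝ] E in 𝓝 G, c < γ (G' ⁻¹' U) := by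
  obtain ⟨Q, hQU, hQ, hcQ⟩ := (hU.preimage G.continuous).exists_lt_isCompact hc
  have : ∀ᶠ G' : E →L[ℝ] E in 𝓝 G, ∀ z ∈ Q, G' z ∈ U := by
    refine hQ.eventually_forall_of_forall_eventually fun z hz => ?_
    have hcont : Continuous fun p : (E →L[ℝ] E) × E => p.1 p.2 := by fun_prop
    exact hcont.continuousAt.eventually (hU.mem_nhds (hQU hz))
  filter_upwards [this] with G' hG'
  exact hcQ.trans_le (measure_mono hG')

/-- A uniform version over compact sets of operators of continuity from below. -/
theorem exists_forall_lt_measure_preimage {γ : Measure E} [γ.Regular] {U : ℕ → Set E}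
    (hU : ∀ m, IsOpen (U m)) (hmono : Monotone U) {K : Set (E →L[ℝ] E)} (hK : IsCompact K)
    {c : ℝ≥0∞} (hc : ∀ G ∈ K, c < γ (G ⁻¹' ⋃ m, U m)) :
    ∃ m, ∀ G ∈ K, c < γ (G ⁻¹' U m) := by
  refine hK.induction_on (p := fun s => ∃ m, ∀ G ∈ s, c < γ (G ⁻¹' U m)) ?_ ?_ ?_ ?_
  · exact ⟨0, by simp⟩
  · rintro s t hst ⟨m, hm⟩
    exact ⟨m, fun G hG => hm G (hst hG)⟩
  · rintro s t ⟨m, hm⟩ ⟨l, hl⟩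
    refine ⟨max m l, fun G hG => ?_⟩
    rcases hG with hG | hG
    · exact (hm G hG).trans_le (measure_mono (Set.preimage_mono (hmono (le_max_left _ _))))
    · exact (hl G hG).trans_le (measure_mono (Set.preimage_mono (hmono (le_max_right _ _))))
  · intro G hG
    have h := hc G hG
    have hm : Monotone fun m => G ⁻¹' U m := fun a b hab => Set.preimage_mono (hmono hab)
    rw [Set.preimage_iUnion, hm.measure_iUnion, lt_iSup_iff] at h
    obtain ⟨m, hm⟩ := h
    exact ⟨_, mem_nhdsWithin_of_mem_nhds (eventually_lt_measure_preimage (hU m) hm), m,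
      fun G' hG' => hG'⟩

/-- A nonempty open set has probability bounded away from zero over compact sets of
surjective operators. -/
theorem exists_pos_forall_le_measure_preimage {γ : Measure E} [γ.Regular] [γ.IsOpenPosMeasure]
    {U : Set E} (hU : IsOpen U) (hne : U.Nonempty) {K : Set (E →L[ℝ] E)} (hK : IsCompact K)
    (hsurj : ∀ G ∈ K, Function.Surjective G) :
    ∃ η : ℝ≥0∞, 0 < η ∧ ∀ G ∈ K, η ≤ γ (G ⁻¹' U) := by
  refine hK.induction_on (p := fun s => ∃ η : ℝ≥0∞, 0 < η ∧ ∀ G ∈ s, η ≤ γ (G ⁻¹' U)) ?_ ?_ ?_ ?_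
  · exact ⟨1, one_pos, by simp⟩
  · rintro s t hst ⟨m, hm0, hm⟩
    exact ⟨m, hm0, fun G hG => hm G (hst hG)⟩
  · rintro s t ⟨m, hm0, hm⟩ ⟨l, hl0, hl⟩
    refine ⟨min m l, lt_min hm0 hl0, fun G hG => ?_⟩
    rcases hG with hG | hG
    · exact (min_le_left _ _).trans (hm G hG)
    · exact (min_le_right _ _).trans (hl G hG)
  · intro G hG
    have h : 0 < γ (G ⁻¹' U) :=
      (hU.preimage G.continuous).measure_pos _ (hne.preimage (hsurj G hG))
    obtain ⟨c, hc0, hc⟩ := exists_between h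
    exact ⟨_, mem_nhdsWithin_of_mem_nhds (eventually_lt_measure_preimage hU hc), c, hc0,
      fun G' hG' => le_of_lt hG'⟩

end Compactness

/-! ### Rank conditions and least squares. -/

section LinearAlgebra

variable {n k q : ℕ}

theorem linearIndependent_row_of_rank_eq {ι m : Type*} [Fintype ι] [Fintype m] {M : Matrix m ι ℝ}
    (hM : M.rank = Fintype.card m) : LinearIndependent ℝ M.row := by
  rw [linearIndependent_iff_card_eq_finrank_span, ← hM, rank_eq_finrank_span_row, Set.finrank]

theorem isUnit_det_gram {X : Matrix (Fin n) (Fin k) ℝ} (hX : X.rank = k) :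
    IsUnit (Xᵀ * X).det := by
  have h : (Xᵀ * X).rank = Fintype.card (Fin k) := by
    rw [rank_transpose_mul_self, hX, Fintype.card_fin]
  rw [← isUnit_iff_isUnit_det]
  exact linearIndependent_rows_iff_isUnit.1 (linearIndependent_row_of_rank_eq h)

theorem transpose_inv_gram (X : Matrix (Fin n) (Fin k) ℝ) : (Xᵀ * X)⁻¹ᵀ = (Xᵀ * X)⁻¹ := by
  rw [transpose_nonsing_inv, transpose_mul, transpose_transpose]

theorem vecMul_injective_of_rank_eq {ι : Type*} [Fintype ι] {M : Matrix (Fin q) ι ℝ}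
    (hM : M.rank = q) {x : Fin q → ℝ} (hx : x ᵥ* M = 0) : x = 0 := by
  have h : LinearIndependent ℝ M.row :=
    linearIndependent_row_of_rank_eq (by rw [hM, Fintype.card_fin])
  exact (vecMul_injective_iff.2 h) (by simpa using hx)

theorem exists_rightInverse_of_rank_eq {R : Matrix (Fin q) (Fin k) ℝ} (hR : R.rank = q) :
    ∃ S : Matrix (Fin k) (Fin q) ℝ, R * S = 1 := by
  have h : IsUnit (Rᵀᵀ * Rᵀ).det := isUnit_det_gram (by rw [rank_transpose, hR])
  refine ⟨Rᵀ * (Rᵀᵀ * Rᵀ)⁻¹, ?_⟩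
  rw [← Matrix.mul_assoc]
  exact mul_nonsing_inv _ h

theorem betaHat_smul (X : Matrix (Fin n) (Fin k) ℝ) (c : ℝ) (y : EuclideanSpace ℝ (Fin n)) :
    betaHat X (c • y) = c • betaHat X y := by
  simp [betaHat, mulVec_smul]

theorem betaHat_add (X : Matrix (Fin n) (Fin k) ℝ) (y z : EuclideanSpace ℝ (Fin n)) :
    betaHat X (y + z) = betaHat X y + betaHat X z := by
  simp [betaHat, mulVec_add]

theorem betaHat_toLp_mulVec {X : Matrix (Fin n) (Fin k) ℝ} (hX : X.rank = k) (β : Fin k → ℝ) :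
    betaHat X (WithLp.toLp 2 (X *ᵥ β)) = β := by
  simp [betaHat, mulVec_mulVec, nonsing_inv_mul _ (isUnit_det_gram hX)]

theorem residual_smul (X : Matrix (Fin n) (Fin k) ℝ) (c : ℝ) (y : EuclideanSpace ℝ (Fin n)) :
    residual X (c • y) = c • residual X y := by
  simp [residual, betaHat_smul, mulVec_smul, smul_sub]

theorem residual_add (X : Matrix (Fin n) (Fin k) ℝ) (y z : EuclideanSpace ℝ (Fin n)) :
    residual X (y + z) = residual X y + residual X z := by
  simp only [residual, betaHat_add, mulVec_add, WithLp.ofLp_add]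
  abel

theorem residual_toLp_mulVec {X : Matrix (Fin n) (Fin k) ℝ} (hX : X.rank = k) (β : Fin k → ℝ) :
    residual X (WithLp.toLp 2 (X *ᵥ β)) = 0 := by
  simp [residual, betaHat_toLp_mulVec hX]

theorem continuous_betaHat (X : Matrix (Fin n) (Fin k) ℝ) : Continuous (betaHat X) := by
  unfold betaHat
  fun_prop

theorem continuous_residual (X : Matrix (Fin n) (Fin k) ℝ) : Continuous (residual X) := by
  have := continuous_betaHat X
  unfold residual
  fun_prop

end LinearAlgebra

/-! ### The covariance estimator as a quadratic form in the residuals. -/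

section Omega

variable {n k q : ℕ}

theorem autocov_eq (X : Matrix (Fin n) (Fin k) ℝ) (y : EuclideanSpace ℝ (Fin n)) (j : ℤ) :
    autocov X y j = (n : ℝ)⁻¹ • ∑ t : Fin n, ∑ s : Fin n,
      if (t : ℤ) = s + j then vecMulVec (score X y t) (score X y s) else 0 := by
  unfold autocov autocovNat
  split_ifs with hj
  · congr! 6 with t _ s _
    omega
  · rw [transpose_smul, transpose_sum, Finset.sum_congr rfl fun t _ => transpose_sum _ _,
      Finset.sum_comm]
    refine congrArg _ (Finset.sum_congr rfl fun t _ => Finset.sum_congr rfl fun s _ => ?_)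
    split_ifs with h1 h2 h2
    · rw [transpose_vecMulVec]
    · omega
    · omega
    · exact transpose_zero

/-- The Toeplitz matrix of the weights. -/
def weightMatrix (n : ℕ) (w : ℤ → ℝ) : Matrix (Fin n) (Fin n) ℝ :=
  Matrix.of fun i j : Fin n => w ((i : ℤ) - (j : ℤ))

theorem psiHat_eq (w : ℤ → ℝ) (X : Matrix (Fin n) (Fin k) ℝ) (y : EuclideanSpace ℝ (Fin n)) :
    psiHat w X y = (n : ℝ)⁻¹ • ∑ t : Fin n, ∑ s : Fin n,
      w ((t : ℤ) - s) • vecMulVec (score X y t) (score X y s) := by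
  unfold psiHat
  simp_rw [autocov_eq, smul_comm _ (n : ℝ)⁻¹, ← Finset.smul_sum]
  congr 1
  simp_rw [Finset.smul_sum]
  rw [Finset.sum_comm]
  refine Finset.sum_congr rfl fun t _ => ?_
  rw [Finset.sum_comm]
  refine Finset.sum_congr rfl fun s _ => ?_
  -- Each pair `(t, s)` contributes at the single lag `t - s`, which always lies in the summation
  -- range.
  rw [Finset.sum_eq_single ((t : ℤ) - s)]
  · simp
  · intro j _ hj
    rw [if_neg (by omega), smul_zero]
  · intro h
    exact absurd (Finset.mem_Icc.2 ⟨by omega, by omega⟩) h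

theorem psiHat_eq_mul (w : ℤ → ℝ) (X : Matrix (Fin n) (Fin k) ℝ) (y : EuclideanSpace ℝ (Fin n)) :
    psiHat w X y = (n : ℝ)⁻¹ •
      (Xᵀ * diagonal (residual X y) * weightMatrix n w * (Xᵀ * diagonal (residual X y))ᵀ) := by
  rw [psiHat_eq]
  congr 1
  ext a b
  simp only [Matrix.sum_apply, Matrix.smul_apply, vecMulVec_apply, score, Pi.smul_apply,
    smul_eq_mul]
  have hB : ∀ a t, (Xᵀ * diagonal (residual X y)) a t = residual X y t * X t a := fun a t => by
    rw [mul_diagonal, transpose_apply, mul_comm]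
  generalize Xᵀ * diagonal (residual X y) = B at hB
  simp only [Matrix.mul_apply, transpose_apply, weightMatrix, Matrix.of_apply, Finset.sum_mul, hB]
  rw [Finset.sum_comm]
  refine Finset.sum_congr rfl fun t _ => Finset.sum_congr rfl fun s _ => ?_
  ring

/-- The matrix `R (X'X)⁻¹ X' diag(û(y))`. -/
noncomputable def scoreFactor (X : Matrix (Fin n) (Fin k) ℝ) (R : Matrix (Fin q) (Fin k) ℝ)
    (y : EuclideanSpace ℝ (Fin n)) : Matrix (Fin q) (Fin n) ℝ :=
  R * (Xᵀ * X)⁻¹ * Xᵀ * diagonal (residual X y)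

theorem omegaHat_eq (hn : n ≠ 0) (w : ℤ → ℝ) (X : Matrix (Fin n) (Fin k) ℝ)
    (R : Matrix (Fin q) (Fin k) ℝ) (y : EuclideanSpace ℝ (Fin n)) :
    omegaHat w X R y = scoreFactor X R y * weightMatrix n w * (scoreFactor X R y)ᵀ := by
  have hn' : (n : ℝ) ≠ 0 := by exact_mod_cast hn
  rw [omegaHat, psiHat_eq_mul, scoreFactor]
  simp only [Matrix.mul_smul, Matrix.smul_mul, smul_smul, mul_inv_cancel₀ hn', one_smul,
    transpose_mul, transpose_inv_gram, transpose_transpose, Matrix.mul_assoc]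

theorem continuous_omegaHat (hn : n ≠ 0) (w : ℤ → ℝ) (X : Matrix (Fin n) (Fin k) ℝ)
    (R : Matrix (Fin q) (Fin k) ℝ) : Continuous (omegaHat w X R) := by
  have := continuous_residual X
  have h : omegaHat w X R = fun y =>
      scoreFactor X R y * weightMatrix n w * (scoreFactor X R y)ᵀ :=
    funext (omegaHat_eq hn w X R)
  rw [h]
  unfold scoreFactor
  fun_prop

theorem omegaHat_smul (hn : n ≠ 0) (w : ℤ → ℝ) (X : Matrix (Fin n) (Fin k) ℝ)
    (R : Matrix (Fin q) (Fin k) ℝ) (c : ℝ) (y : EuclideanSpace ℝ (Fin n)) :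
    omegaHat w X R (c • y) = c ^ 2 • omegaHat w X R y := by
  have h : scoreFactor X R (c • y) = c • scoreFactor X R y := by
    rw [scoreFactor, scoreFactor, residual_smul, ← Matrix.mul_smul, diagonal_smul]
  rw [omegaHat_eq hn, omegaHat_eq hn, h]
  simp [Matrix.mul_smul, Matrix.smul_mul, smul_smul, sq]

theorem omegaHat_add_toLp_mulVec {X : Matrix (Fin n) (Fin k) ℝ} (hX : X.rank = k) (w : ℤ → ℝ)
    (R : Matrix (Fin q) (Fin k) ℝ) (y : EuclideanSpace ℝ (Fin n)) (β : Fin k → ℝ) :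
    omegaHat w X R (WithLp.toLp 2 (X *ᵥ β) + y) = omegaHat w X R y := by
  have h : residual X (WithLp.toLp 2 (X *ᵥ β) + y) = residual X y := by
    rw [residual_add, residual_toLp_mulVec hX, zero_add]
  simp only [omegaHat, psiHat, autocov, autocovNat, score, h]

/-- The estimator is `B W B'` with `W` positive definite, so it suffices that `x ↦ x' B` is
injective. Dividing by the nonzero residuals leaves the columns kept in the design condition, which
have full row rank. -/
theorem posDef_omegaHat (hn : n ≠ 0) {w : ℤ → ℝ} (hw : AdmissibleWeights n w)
    {X : Matrix (Fin n) (Fin k) ℝ} {R : Matrix (Fin q) (Fin k) ℝ} (hXR : DesignCondition X R)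
    {y : EuclideanSpace ℝ (Fin n)}
    (hy : ∀ i, EuclideanSpace.single i (1 : ℝ) ∉ meanSpace X → residual X y i ≠ 0) :
    (omegaHat w X R y).PosDef := by
  rw [omegaHat_eq hn, ← conjTranspose_eq_transpose_of_trivial]
  have hW : (weightMatrix n w).PosDef := hw.posDef
  refine hW.mul_mul_conjTranspose_same ?_
  intro x z hxz
  rw [← sub_eq_zero]
  classical
  refine vecMul_injective_of_rank_eq hXR ?_
  have h0 : (x - z) ᵥ* scoreFactor X R y = 0 := by
    rw [sub_vecMul, sub_eq_zero]; exact hxz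
  ext ⟨i, hi⟩
  have h1 := congrFun h0 i
  rw [scoreFactor, ← vecMul_vecMul, vecMul_diagonal] at h1
  have h2 := (mul_eq_zero.1 h1).resolve_right (hy i hi)
  simpa [vecMul, dotProduct, Matrix.mul_apply] using h2

theorem transpose_mulVec_residual {X : Matrix (Fin n) (Fin k) ℝ} (hX : X.rank = k)
    (y : EuclideanSpace ℝ (Fin n)) : Xᵀ *ᵥ residual X y = 0 := by
  simp [residual, betaHat, mulVec_sub, mulVec_mulVec, mul_nonsing_inv _ (isUnit_det_gram hX),
    ← Matrix.mul_assoc]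

/-- Taking residuals is an orthogonal projection, so the `i`-th residual of `e_i` equals its squared
residual norm, which vanishes only if `e_i` lies in the column space. -/
theorem residual_single_ne_zero {X : Matrix (Fin n) (Fin k) ℝ} (hX : X.rank = k) {i : Fin n}
    (hi : EuclideanSpace.single i (1 : ℝ) ∉ meanSpace X) : ∃ y, residual X y i ≠ 0 := by
  set e := EuclideanSpace.single i (1 : ℝ) with he
  refine ⟨e, fun h => hi ⟨betaHat X e, ?_⟩⟩
  have h1 : residual X e ⬝ᵥ residual X e = 0 := by
    nth_rewrite 2 [residual]
    rw [dotProduct_sub, dotProduct_mulVec, ← mulVec_transpose,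
      transpose_mulVec_residual hX, zero_dotProduct, sub_zero, he]
    simpa using h
  have h2 := dotProduct_self_eq_zero.1 h1
  rw [residual, sub_eq_zero] at h2
  rw [← h2]

end Omega

/-! ### The test statistic: bounds, regularity, equivariance. -/

section Statistic

variable {n k q : ℕ}

/-- The entry sum bounds the form `Ω` by `s` times the squared sup norm. The bound passes to `Ω⁻¹`
by expanding the nonnegative value of the form at `Ω⁻¹ x - s⁻¹ x`. -/
theorem sq_norm_div_le_dotProduct_inv_mulVec {Ω : Matrix (Fin q) (Fin q) ℝ} (hΩ : Ω.PosDef)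
    (x : Fin q → ℝ) {s : ℝ} (hs : 0 < s) (hle : ∑ i, ∑ j, |Ω i j| ≤ s) :
    ‖x‖ ^ 2 / s ≤ x ⬝ᵥ Ω⁻¹ *ᵥ x := by
  have hdet : IsUnit Ω.det := (isUnit_iff_isUnit_det _).1 hΩ.isUnit
  have hnorm : ‖x‖ ^ 2 ≤ x ⬝ᵥ x := by
    have h0 : 0 ≤ x ⬝ᵥ x := Finset.sum_nonneg fun i _ => mul_self_nonneg _
    have : ‖x‖ ≤ √(x ⬝ᵥ x) := by
      refine (pi_norm_le_iff_of_nonneg (Real.sqrt_nonneg _)).2 fun i => ?_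
      rw [Real.norm_eq_abs]
      refine Real.abs_le_sqrt ?_
      rw [sq]
      exact Finset.single_le_sum (f := fun i => x i * x i) (fun i _ => mul_self_nonneg _)
        (Finset.mem_univ i)
    calc ‖x‖ ^ 2 ≤ √(x ⬝ᵥ x) ^ 2 := by gcongr
      _ = _ := Real.sq_sqrt h0
  have hquad : x ⬝ᵥ Ω *ᵥ x ≤ s * ‖x‖ ^ 2 := by
    calc x ⬝ᵥ Ω *ᵥ x ≤ ∑ i, ∑ j, |Ω i j| * ‖x‖ ^ 2 := by
          simp only [dotProduct, mulVec, Finset.mul_sum]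
          refine Finset.sum_le_sum fun i _ => Finset.sum_le_sum fun j _ => ?_
          calc x i * (Ω i j * x j) ≤ |x i * (Ω i j * x j)| := le_abs_self _
            _ = |Ω i j| * (‖x i‖ * ‖x j‖) := by
                rw [abs_mul, abs_mul, Real.norm_eq_abs, Real.norm_eq_abs]; ring
            _ ≤ |Ω i j| * (‖x‖ * ‖x‖) := by gcongr <;> exact norm_le_pi_norm x _
            _ = _ := by ring
      _ = (∑ i, ∑ j, |Ω i j|) * ‖x‖ ^ 2 := by simp only [Finset.sum_mul]
      _ ≤ _ := by gcongr
  set z := Ω⁻¹ *ᵥ x with hz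
  have hΩz : Ω *ᵥ z = x := by rw [hz, mulVec_mulVec, mul_nonsing_inv _ hdet, one_mulVec]
  have hsymm : z ⬝ᵥ Ω *ᵥ x = x ⬝ᵥ x := by
    rw [dotProduct_mulVec, ← mulVec_transpose, ← conjTranspose_eq_transpose_of_trivial,
      hΩ.isHermitian.eq, hΩz]
  have h0 : 0 ≤ (z - s⁻¹ • x) ⬝ᵥ Ω *ᵥ (z - s⁻¹ • x) := by
    simpa using hΩ.posSemidef.dotProduct_mulVec_nonneg (z - s⁻¹ • x)
  have hexp : (z - s⁻¹ • x) ⬝ᵥ Ω *ᵥ (z - s⁻¹ • x)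
      = x ⬝ᵥ z - 2 * s⁻¹ * (x ⬝ᵥ x) + s⁻¹ ^ 2 * (x ⬝ᵥ Ω *ᵥ x) := by
    rw [mulVec_sub, mulVec_smul, hΩz]
    simp only [sub_dotProduct, dotProduct_sub, smul_dotProduct, dotProduct_smul, smul_eq_mul,
      hsymm, dotProduct_comm z x]
    ring
  have h1 : s⁻¹ ^ 2 * (x ⬝ᵥ Ω *ᵥ x) ≤ s⁻¹ * ‖x‖ ^ 2 := by
    calc s⁻¹ ^ 2 * (x ⬝ᵥ Ω *ᵥ x) ≤ s⁻¹ ^ 2 * (s * ‖x‖ ^ 2) := by gcongr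
      _ = _ := by field_simp
  have h2 : s⁻¹ * ‖x‖ ^ 2 ≤ s⁻¹ * (x ⬝ᵥ x) := by gcongr
  rw [div_eq_inv_mul]
  linarith

/-- With `x / 0 = 0` this formula covers the singular case too; numerator and denominator are
continuous, which yields measurability and continuity off `det = 0`. -/
theorem testStat_eq_div (w : ℤ → ℝ) (X : Matrix (Fin n) (Fin k) ℝ) (R : Matrix (Fin q) (Fin k) ℝ)
    (r : Fin q → ℝ) (y : EuclideanSpace ℝ (Fin n)) :
    testStat w X R r y = (R *ᵥ betaHat X y - r) ⬝ᵥ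
      ((omegaHat w X R y).adjugate *ᵥ (R *ᵥ betaHat X y - r)) / (omegaHat w X R y).det := by
  unfold testStat
  split_ifs with h
  · rw [Matrix.inv_def, Ring.inverse_eq_inv', smul_mulVec, dotProduct_smul, smul_eq_mul,
      div_eq_inv_mul]
  · rw [not_not.1 h, div_zero]

variable (w : ℤ → ℝ) {X : Matrix (Fin n) (Fin k) ℝ} (R : Matrix (Fin q) (Fin k) ℝ)

theorem measurable_testStat (hn : n ≠ 0) (X : Matrix (Fin n) (Fin k) ℝ) (r : Fin q → ℝ) :
    Measurable (testStat w X R r) := by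
  rw [funext (testStat_eq_div w X R r)]
  have h1 := continuous_betaHat X
  have h2 := continuous_omegaHat hn w X R
  refine Measurable.div (Continuous.measurable ?_) (Continuous.measurable ?_)
  · have h3 : Continuous fun y => (omegaHat w X R y).adjugate := h2.matrix_adjugate
    fun_prop
  · fun_prop

theorem isOpen_setOf_testStat_mem (hn : n ≠ 0) (X : Matrix (Fin n) (Fin k) ℝ) (r : Fin q → ℝ)
    {s : Set ℝ} (hs : IsOpen s) :
    IsOpen {y | (omegaHat w X R y).det ≠ 0 ∧ testStat w X R r y ∈ s} := by
  have h1 := continuous_betaHat X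
  have h2 := continuous_omegaHat hn w X R
  have h3 : Continuous fun y => (omegaHat w X R y).adjugate := h2.matrix_adjugate
  have hopen : IsOpen {y | (omegaHat w X R y).det ≠ 0} :=
    isOpen_ne_fun (by fun_prop) continuous_const
  refine ContinuousOn.isOpen_inter_preimage ?_ hopen hs
  rw [funext (testStat_eq_div w X R r)]
  exact ContinuousOn.div (Continuous.continuousOn (by fun_prop))
    (Continuous.continuousOn (by fun_prop)) fun y hy => hy

/-- The statistic with `r = 0` takes into account all hypotheses by translation; a change of
scale only rescales the deviation from the hypothesis. -/
theorem testStat_toLp_mulVec_add_smul (hn : n ≠ 0) (hX : X.rank = k) (r : Fin q → ℝ)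
    (β : Fin k → ℝ) {c : ℝ} (hc : c ≠ 0) (y : EuclideanSpace ℝ (Fin n)) :
    testStat w X R r (WithLp.toLp 2 (X *ᵥ β) + c • y)
      = testStat w X R (c⁻¹ • (r - R *ᵥ β)) y := by
  have hΩ : omegaHat w X R (WithLp.toLp 2 (X *ᵥ β) + c • y) = c ^ 2 • omegaHat w X R y := by
    rw [omegaHat_add_toLp_mulVec hX, omegaHat_smul hn]
  have hb : R *ᵥ betaHat X (WithLp.toLp 2 (X *ᵥ β) + c • y) - r
      = c • (R *ᵥ betaHat X y - c⁻¹ • (r - R *ᵥ β)) := by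
    rw [betaHat_add, betaHat_toLp_mulVec hX, betaHat_smul, mulVec_add, mulVec_smul, smul_sub,
      smul_inv_smul₀ hc]
    abel
  unfold testStat
  rw [hΩ, hb, det_smul]
  have hc2 : (c ^ 2) ^ Fintype.card (Fin q) ≠ 0 := by positivity
  by_cases h : (omegaHat w X R y).det = 0
  · simp [h]
  · rw [if_pos (mul_ne_zero hc2 h), if_pos h]
    have hinv : (c ^ 2 • omegaHat w X R y)⁻¹ = (c ^ 2)⁻¹ • (omegaHat w X R y)⁻¹ := by
      refine inv_eq_left_inv ?_
      rw [Matrix.smul_mul, Matrix.mul_smul, smul_smul, inv_mul_cancel₀ (by positivity), one_smul,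
        nonsing_inv_mul _ (Ne.isUnit h)]
    rw [hinv, smul_mulVec, mulVec_smul, dotProduct_smul, dotProduct_smul, smul_dotProduct]
    simp only [smul_eq_mul]
    field_simp

theorem testStat_toLp_mulVec_add (hn : n ≠ 0) (hX : X.rank = k) (r : Fin q → ℝ)
    (β : Fin k → ℝ) (y : EuclideanSpace ℝ (Fin n)) :
    testStat w X R r (WithLp.toLp 2 (X *ᵥ β) + y) = testStat w X R (r - R *ᵥ β) y := by
  simpa using testStat_toLp_mulVec_add_smul w R hn hX r β one_ne_zero y

variable {w R}

theorem testStat_of_posDef {r : Fin q → ℝ} {y : EuclideanSpace ℝ (Fin n)}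
    (hy : (omegaHat w X R y).PosDef) :
    testStat w X R r y = (R *ᵥ betaHat X y - r) ⬝ᵥ
      ((omegaHat w X R y)⁻¹ *ᵥ (R *ᵥ betaHat X y - r)) :=
  if_pos hy.det_pos.ne'

/-- The parallelogram identity for `Ω⁻¹`: the statistics at `y` and `-y` add up to at least twice
the statistic for `r = 0`. -/
theorem le_testStat_or_le_testStat_neg (hn : n ≠ 0) {r : Fin q → ℝ} {C : ℝ}
    {y : EuclideanSpace ℝ (Fin n)} (hy : (omegaHat w X R y).PosDef)
    (hC : C ≤ testStat w X R 0 y) :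
    C ≤ testStat w X R r y ∨ C ≤ testStat w X R r (-y) := by
  have hneg : omegaHat w X R (-y) = omegaHat w X R y := by
    simpa using omegaHat_smul hn w X R (-1) y
  have hbneg : betaHat X (-y) = -betaHat X y := by simpa using betaHat_smul X (-1) y
  have hy' : (omegaHat w X R (-y)).PosDef := by rwa [hneg]
  rw [testStat_of_posDef hy] at hC
  rw [testStat_of_posDef hy, testStat_of_posDef hy', hneg, hbneg, mulVec_neg]
  set h := R *ᵥ betaHat X y
  set M := (omegaHat w X R y)⁻¹
  have hr : 0 ≤ r ⬝ᵥ M *ᵥ r := by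
    simpa using hy.inv.posSemidef.dotProduct_mulVec_nonneg r
  have hsum : (h - r) ⬝ᵥ M *ᵥ (h - r) + (-h - r) ⬝ᵥ M *ᵥ (-h - r)
      = 2 * (h ⬝ᵥ M *ᵥ h) + 2 * (r ⬝ᵥ M *ᵥ r) := by
    simp only [mulVec_sub, mulVec_neg, sub_dotProduct, dotProduct_sub, neg_dotProduct,
      dotProduct_neg]
    ring
  rw [sub_zero] at hC
  by_contra! hcon
  linarith

end Statistic

/-! ### Rejection probabilities uniformly over a compact set of invertible operators. -/

section Uniform

variable {n k q : ℕ} {w : ℤ → ℝ} {X : Matrix (Fin n) (Fin k) ℝ} {R : Matrix (Fin q) (Fin k) ℝ}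

local notation "𝔼" => EuclideanSpace ℝ (Fin n)

/-- Each relevant residual is a nonzero linear functional of `z`, as `G` is onto, so it vanishes
only on a null set. -/
theorem ae_posDef_omegaHat (hn : n ≠ 0) (hX : X.rank = k) (hw : AdmissibleWeights n w)
    (hXR : DesignCondition X R) {G : 𝔼 →L[ℝ] 𝔼} (hG : Function.Surjective G) :
    ∀ᵐ z ∂(stdGaussian 𝔼), (omegaHat w X R (G z)).PosDef := by
  have h : ∀ᵐ z ∂(stdGaussian 𝔼), ∀ i : Fin n,
      EuclideanSpace.single i (1 : ℝ) ∉ meanSpace X → residual X (G z) i ≠ 0 := by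
    rw [ae_all_iff]
    intro i
    by_cases hi : EuclideanSpace.single i (1 : ℝ) ∈ meanSpace X
    · exact Eventually.of_forall fun z h => absurd hi h
    obtain ⟨y, hy⟩ := residual_single_ne_zero hX hi
    obtain ⟨z, rfl⟩ := hG y
    let L : StrongDual ℝ 𝔼 :=
      { toFun := fun z => residual X (G z) i
        map_add' := fun a b => by rw [map_add, residual_add, Pi.add_apply]
        map_smul' := fun c a => by rw [map_smul, residual_smul, Pi.smul_apply, RingHom.id_apply]
        cont := by
          have := continuous_residual X
          fun_prop }
    have hL : L ≠ 0 := fun h => hy (DFunLike.congr_fun h z : L z = 0)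
    have h0 := stdGaussian_ker_eq_zero L hL
    filter_upwards [measure_eq_zero_iff_ae_notMem.1 h0] with z hz _ using hz
  filter_upwards [h] with z hz using posDef_omegaHat hn hw hXR hz

theorem exists_posDef_omegaHat (hn : n ≠ 0) (hX : X.rank = k) (hw : AdmissibleWeights n w)
    (hXR : DesignCondition X R) : ∃ y, (omegaHat w X R y).PosDef :=
  (ae_posDef_omegaHat hn hX hw hXR (G := ContinuousLinearMap.id ℝ _)
    Function.surjective_id).exists

theorem measurableSet_setOf_le_testStat (hn : n ≠ 0) (r : Fin q → ℝ) (C : ℝ) (G : 𝔼 →L[ℝ] 𝔼) :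
    MeasurableSet {z | C ≤ testStat w X R r (G z)} :=
  measurableSet_le measurable_const
    ((measurable_testStat w R hn X r).comp G.continuous.measurable)

theorem measure_le_testStat_le_of_subset (hn : n ≠ 0) {r : Fin q → ℝ} {C : ℝ} {G : 𝔼 →L[ℝ] 𝔼}
    {U : Set 𝔼} (hU : ∀ y ∈ U, testStat w X R r y < C) {η : ℝ≥0∞}
    (hη : η ≤ stdGaussian 𝔼 (G ⁻¹' U)) :
    stdGaussian 𝔼 {z | C ≤ testStat w X R r (G z)} ≤ 1 - η := by
  have hm := measurableSet_setOf_le_testStat (w := w) (X := X) (R := R) hn r C G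
  have h := prob_compl_eq_one_sub (μ := stdGaussian 𝔼) hm.compl
  rw [compl_compl] at h
  rw [h]
  refine tsub_le_tsub_left (hη.trans (measure_mono fun z hz => ?_)) _
  exact not_le.2 (hU _ hz)

variable {K : Set (EuclideanSpace ℝ (Fin n) →L[ℝ] EuclideanSpace ℝ (Fin n))}

theorem exists_size_le_one_sub (hn : n ≠ 0) (hX : X.rank = k) (hw : AdmissibleWeights n w)
    (hXR : DesignCondition X R) (hK : IsCompact K) (hsurj : ∀ G ∈ K, Function.Surjective G)
    {C : ℝ} (hC : 0 < C) :
    ∃ η : ℝ≥0∞, 0 < η ∧ ∀ G ∈ K,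
      stdGaussian 𝔼 {z | C ≤ testStat w X R 0 (G z)} ≤ 1 - η := by
  obtain ⟨y, hy⟩ := exists_posDef_omegaHat hn hX hw hXR
  have hne : {y | (omegaHat w X R y).det ≠ 0 ∧ testStat w X R 0 y ∈ Set.Iio C}.Nonempty := by
    -- Removing the fitted part makes the estimate zero, hence the statistic zero, without changing
    -- the covariance estimator.
    refine ⟨WithLp.toLp 2 (X *ᵥ (-betaHat X y)) + y, ?_, ?_⟩
    · rw [omegaHat_add_toLp_mulVec hX]
      exact hy.det_pos.ne'
    · rw [testStat_toLp_mulVec_add w R hn hX, testStat_of_posDef hy, mulVec_neg]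
      simpa using hC
  obtain ⟨η, hη, h⟩ := exists_pos_forall_le_measure_preimage (γ := stdGaussian 𝔼)
    (isOpen_setOf_testStat_mem w R hn X 0 isOpen_Iio) hne hK hsurj
  exact ⟨η, hη, fun G hG => measure_le_testStat_le_of_subset hn (fun y hy => hy.2) (h G hG)⟩

theorem exists_le_null_rejection (hn : n ≠ 0) (hq : 1 ≤ q) (hX : X.rank = k) (hR : R.rank = q)
    (hw : AdmissibleWeights n w) (hXR : DesignCondition X R) (hK : IsCompact K)
    (hsurj : ∀ G ∈ K, Function.Surjective G) {C : ℝ} (hC : 0 < C) :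
    ∃ η : ℝ≥0∞, 0 < η ∧ ∀ G ∈ K,
      η ≤ stdGaussian 𝔼 {z | C ≤ testStat w X R 0 (G z)} := by
  obtain ⟨y, hy⟩ := exists_posDef_omegaHat hn hX hw hXR
  obtain ⟨S, hS⟩ := exists_rightInverse_of_rank_eq hR
  set s := ∑ i, ∑ j, |omegaHat w X R y i j| + 1 with hs
  have hs0 : 0 < s := by positivity
  have hne : {y | (omegaHat w X R y).det ≠ 0 ∧ testStat w X R 0 y ∈ Set.Ioi C}.Nonempty := by
    -- The shift moves `R β̂` to the constant vector `C s + 1` and keeps the covariance estimator;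
    -- the statistic is then at least `(C s + 1)² / s > C`.
    refine ⟨WithLp.toLp 2 (X *ᵥ (S *ᵥ (fun _ => C * s + 1) - betaHat X y)) + y, ?_, ?_⟩
    · rw [omegaHat_add_toLp_mulVec hX]
      exact hy.det_pos.ne'
    · rw [testStat_toLp_mulVec_add w R hn hX, testStat_of_posDef hy, mulVec_sub, mulVec_mulVec, hS,
        one_mulVec, zero_sub, sub_neg_eq_add, add_sub_cancel]
      refine lt_of_lt_of_le ?_ (sq_norm_div_le_dotProduct_inv_mulVec hy _ hs0 (by linarith))
      have : Nonempty (Fin q) := ⟨⟨0, hq⟩⟩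
      rw [pi_norm_const, Real.norm_eq_abs, sq_abs, lt_div_iff₀ hs0]
      nlinarith [mul_pos hC hs0]
  obtain ⟨η, hη, h⟩ := exists_pos_forall_le_measure_preimage (γ := stdGaussian 𝔼)
    (isOpen_setOf_testStat_mem w R hn X 0 isOpen_Ioi) hne hK hsurj
  refine ⟨η, hη, fun G hG => (h G hG).trans (measure_mono fun z hz => ?_)⟩
  exact le_of_lt (Set.mem_Ioi.1 hz.2)

theorem half_null_rejection_le (hn : n ≠ 0) (hX : X.rank = k) (hw : AdmissibleWeights n w)
    (hXR : DesignCondition X R) {G : 𝔼 →L[ℝ] 𝔼} (hG : Function.Surjective G) (C : ℝ)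
    (r : Fin q → ℝ) :
    stdGaussian 𝔼 {z | C ≤ testStat w X R 0 (G z)} / 2
      ≤ stdGaussian 𝔼 {z | C ≤ testStat w X R r (G z)} := by
  set A := {z | C ≤ testStat w X R r (G z)} with hA
  have hm : MeasurableSet A := measurableSet_setOf_le_testStat hn r C G
  have hneg : stdGaussian 𝔼 ((fun z => -z) ⁻¹' A) = stdGaussian 𝔼 A := by
    rw [← Measure.map_apply measurable_neg hm, stdGaussian_map_neg]
  have hle : stdGaussian 𝔼 {z | C ≤ testStat w X R 0 (G z)}
      ≤ stdGaussian 𝔼 (A ∪ (fun z => -z) ⁻¹' A) := by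
    refine measure_mono_ae ?_
    filter_upwards [ae_posDef_omegaHat hn hX hw hXR hG] with z hz hC
    have := le_testStat_or_le_testStat_neg hn (r := r) hz hC
    rwa [← map_neg] at this
  refine ENNReal.div_le_of_le_mul' ?_
  calc _ ≤ _ := hle.trans (measure_union_le _ _)
    _ = 2 * stdGaussian 𝔼 A := by rw [hneg, two_mul]

theorem exists_le_power_of_norm_ge (hn : n ≠ 0) (hX : X.rank = k) (hw : AdmissibleWeights n w)
    (hXR : DesignCondition X R) (hK : IsCompact K) (hsurj : ∀ G ∈ K, Function.Surjective G)
    {C : ℝ} (hC : 0 < C) {δ : ℝ≥0∞} (hδ : δ ≠ 0) :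
    ∃ N : ℝ, ∀ r : Fin q → ℝ, N ≤ ‖r‖ → ∀ G ∈ K,
      1 - δ ≤ stdGaussian 𝔼 {z | C ≤ testStat w X R r (G z)} := by
  have hlt : (1 : ℝ≥0∞) - δ < 1 := ENNReal.sub_lt_self ENNReal.one_ne_top one_ne_zero hδ
  obtain ⟨m, hm⟩ := exists_forall_lt_measure_preimage (γ := stdGaussian 𝔼)
    (U := fun m : ℕ => Metric.ball 0 m) (fun m => Metric.isOpen_ball)
    (fun a b hab => Metric.ball_subset_ball (by exact_mod_cast hab)) hK (c := 1 - δ)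
    (fun G _ => by rw [Metric.iUnion_ball_nat, Set.preimage_univ, measure_univ]; exact hlt)
  have hcpt : IsCompact (Metric.closedBall (0 : 𝔼) m) := isCompact_closedBall _ _
  have hβ := continuous_betaHat X
  have hΩ := continuous_omegaHat hn w X R
  obtain ⟨b, hb⟩ := hcpt.exists_bound_of_continuousOn (f := fun y => R *ᵥ betaHat X y)
    (Continuous.continuousOn (by fun_prop))
  obtain ⟨s, hs⟩ := hcpt.exists_bound_of_continuousOn
    (f := fun y => ∑ i, ∑ j, |omegaHat w X R y i j|) (Continuous.continuousOn (by fun_prop))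
  set s' := max s 1 with hs'
  have hs0 : 0 < s' := lt_max_of_lt_right one_pos
  -- On the ball `‖R β̂‖ ≤ b`, so this threshold leaves a deviation of norm at least `C s' + 1`,
  -- whose square exceeds `C s'`.
  refine ⟨b + C * s' + 1, fun r hr G hG => (hm G hG).le.trans (measure_mono_ae ?_)⟩
  filter_upwards [ae_posDef_omegaHat hn hX hw hXR (hsurj G hG)] with z hz hball
  have hball' : G z ∈ Metric.closedBall (0 : 𝔼) m := Metric.ball_subset_closedBall hball
  change C ≤ _
  rw [testStat_of_posDef hz]
  refine le_trans ?_ (sq_norm_div_le_dotProduct_inv_mulVec hz _ hs0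
    (((le_abs_self _).trans (hs _ hball')).trans (le_max_left _ _)))
  have h1 := hb _ hball'
  have h2 : C * s' + 1 ≤ ‖R *ᵥ betaHat X (G z) - r‖ := by
    have := norm_sub_norm_le r (R *ᵥ betaHat X (G z))
    rw [norm_sub_rev] at this
    linarith
  rw [le_div_iff₀ hs0]
  have h3 := mul_pos hC hs0
  nlinarith

theorem exists_size_le (hn : n ≠ 0) (hX : X.rank = k) (hw : AdmissibleWeights n w)
    (hXR : DesignCondition X R) (hK : IsCompact K) (hsurj : ∀ G ∈ K, Function.Surjective G)
    {δ : ℝ≥0∞} (hδ : δ ≠ 0) :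
    ∃ C : ℝ, 0 < C ∧ ∀ G ∈ K, stdGaussian 𝔼 {z | C ≤ testStat w X R 0 (G z)} ≤ δ := by
  have hlt : (1 : ℝ≥0∞) - δ < 1 := ENNReal.sub_lt_self ENNReal.one_ne_top one_ne_zero hδ
  obtain ⟨m, hm⟩ := exists_forall_lt_measure_preimage (γ := stdGaussian 𝔼)
    -- Requiring `det ≠ 0` makes the sets open; `m + 1` keeps the resulting critical value positive.
    (U := fun m : ℕ =>
      {y | (omegaHat w X R y).det ≠ 0 ∧ testStat w X R 0 y ∈ Set.Iio ((m : ℝ) + 1)})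
    (fun m => isOpen_setOf_testStat_mem w R hn X 0 isOpen_Iio)
    (fun a b hab y hy => ⟨hy.1, lt_of_lt_of_le (Set.mem_Iio.1 hy.2) (by gcongr)⟩) hK (c := 1 - δ)
    (fun G hG => by
      refine hlt.trans_le (measure_univ (μ := stdGaussian 𝔼) ▸ measure_mono_ae ?_)
      filter_upwards [ae_posDef_omegaHat hn hX hw hXR (hsurj G hG)] with z hz _
      obtain ⟨m, hm⟩ := exists_nat_gt (testStat w X R 0 (G z))
      exact Set.mem_iUnion.2 ⟨m, hz.det_pos.ne', hm.trans (lt_add_one _)⟩)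
  refine ⟨m + 1, by positivity, fun G hG => ?_⟩
  refine (measure_le_testStat_le_of_subset hn (fun y hy => hy.2) (hm G hG).le).trans ?_
  exact tsub_tsub_le

end Uniform

/-! ### Factorization of the AR(1) correlation matrix and its limit at the unit root. -/

section AutoRegression

/-- A square root of the AR(1) correlation matrix with parameter `τ * ρ`, where `τ = ±1`: it maps
the shocks to the stationary autoregressive process. -/
noncomputable def arRoot (n : ℕ) (τ ρ : ℝ) : Matrix (Fin n) (Fin n) ℝ :=
  Matrix.of fun t s => τ ^ (t : ℕ) * if (s : ℕ) = 0 then ρ ^ (t : ℕ) else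
    if (s : ℕ) ≤ t then √(1 - ρ ^ 2) * ρ ^ ((t : ℕ) - s) else 0

/-- The matrix `arRoot`, rescaled by `√(1 - ρ²)` and modified by a multiple of the vector `τ ^ t`;
it stays regular up to `ρ = 1`. -/
noncomputable def shockMatrix (n : ℕ) (τ ρ : ℝ) : Matrix (Fin n) (Fin n) ℝ :=
  Matrix.of fun t s => τ ^ (t : ℕ) *
    if (s : ℕ) = 0 then 1 - √((1 - ρ) / (1 + ρ)) * ∑ i ∈ Finset.range t, ρ ^ i else
      if (s : ℕ) ≤ t then ρ ^ ((t : ℕ) - s) else 0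

/-- The vector with entries `τ ^ t`. -/
def signVector (n : ℕ) (τ : ℝ) : EuclideanSpace ℝ (Fin n) := WithLp.toLp 2 fun t => τ ^ (t : ℕ)

variable {n : ℕ} {τ ρ : ℝ}

/-- Stopping the sum at `m ≤ min i j` makes induction possible: each new shock contributes the
factor `1 - ρ²`, so the sum telescopes. The case `m = i` gives the correlation. -/
theorem sum_range_arRoot (hρ : ρ ^ 2 ≤ 1) {i j m : ℕ} (hmi : m ≤ i) (hmj : m ≤ j) :
    ∑ s ∈ Finset.range (m + 1),
      (if s = 0 then ρ ^ i else if s ≤ i then √(1 - ρ ^ 2) * ρ ^ (i - s) else 0) *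
      (if s = 0 then ρ ^ j else if s ≤ j then √(1 - ρ ^ 2) * ρ ^ (j - s) else 0)
      = ρ ^ ((i - m) + (j - m)) := by
  induction m with
  | zero => simp [pow_add]
  | succ m ih =>
    rw [Finset.sum_range_succ, ih (by omega) (by omega), if_neg m.succ_ne_zero,
      if_neg m.succ_ne_zero, if_pos hmi, if_pos hmj]
    obtain ⟨a, rfl⟩ := Nat.exists_eq_add_of_le hmi
    obtain ⟨b, rfl⟩ := Nat.exists_eq_add_of_le hmj
    have h1 : m + 1 + a - m + (m + 1 + b - m) = a + b + 2 := by omega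
    have h2 : √(1 - ρ ^ 2) * √(1 - ρ ^ 2) = 1 - ρ ^ 2 := Real.mul_self_sqrt (by linarith)
    rw [h1, Nat.add_sub_cancel_left, Nat.add_sub_cancel_left, mul_mul_mul_comm, h2]
    ring

theorem arRoot_mul_transpose (n : ℕ) (hτ : τ ^ 2 = 1) (hρ : ρ ^ 2 ≤ 1) :
    arRoot n τ ρ * (arRoot n τ ρ)ᵀ = ar1Corr n (τ * ρ) := by
  have key : ∀ i j : ℕ, i ≤ j → i < n → ∑ s ∈ Finset.range n,
      (if s = 0 then ρ ^ i else if s ≤ i then √(1 - ρ ^ 2) * ρ ^ (i - s) else 0) *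
      (if s = 0 then ρ ^ j else if s ≤ j then √(1 - ρ ^ 2) * ρ ^ (j - s) else 0)
      = ρ ^ (j - i) := by
    intro i j hij hi
    have h := sum_range_arRoot hρ le_rfl hij
    rw [Nat.sub_self, zero_add] at h
    rw [← h]
    symm
    refine Finset.sum_subset (Finset.range_mono hi) fun s _ hs => ?_
    rw [Finset.mem_range] at hs
    rw [if_neg (by omega), if_neg (by omega), zero_mul]
  have hτ' : ∀ i j : ℕ, i ≤ j → τ ^ i * τ ^ j = τ ^ (j - i) := by
    intro i j hij
    obtain ⟨a, rfl⟩ := Nat.exists_eq_add_of_le hij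
    rw [Nat.add_sub_cancel_left, ← pow_add, ← add_assoc, pow_add, ← two_mul, pow_mul, hτ, one_pow,
      one_mul]
  ext i j
  have hsum : (arRoot n τ ρ * (arRoot n τ ρ)ᵀ) i j = (τ ^ (i : ℕ) * τ ^ (j : ℕ)) *
      ∑ s ∈ Finset.range n,
      (if s = 0 then ρ ^ (i : ℕ) else
        if s ≤ (i : ℕ) then √(1 - ρ ^ 2) * ρ ^ ((i : ℕ) - s) else 0) *
      (if s = 0 then ρ ^ (j : ℕ) else
        if s ≤ (j : ℕ) then √(1 - ρ ^ 2) * ρ ^ ((j : ℕ) - s) else 0) := by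
    rw [← Fin.sum_univ_eq_sum_range, Finset.mul_sum, Matrix.mul_apply]
    refine Finset.sum_congr rfl fun s _ => ?_
    rw [transpose_apply, arRoot, Matrix.of_apply, Matrix.of_apply, mul_mul_mul_comm]
  rw [hsum, ar1Corr, Matrix.of_apply]
  rcases le_total (i : ℕ) j with hij | hij
  · rw [key i j hij i.2, hτ' i j hij, ← mul_pow]
    congr 1
    omega
  · rw [Finset.sum_congr rfl fun s _ => mul_comm _ _, key j i hij j.2,
      mul_comm (τ ^ (i : ℕ)), hτ' j i hij, ← mul_pow]
    congr 1
    omega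

/-- In the first column this is `ρ ^ t = 1 - (1 - ρ) ∑ ρ ^ i`. The coefficient `1 - s` of the
rank-one part, rather than `1`, leaves a `1` in the corner of `shockMatrix`, which keeps it
invertible at `ρ = 1`. -/
theorem arRoot_eq_add (n : ℕ) (τ : ℝ) (h0 : 0 ≤ ρ) (h1 : ρ < 1) :
    arRoot n τ ρ = √(1 - ρ ^ 2) • shockMatrix n τ ρ + (1 - √(1 - ρ ^ 2)) •
      vecMulVec (fun t : Fin n => τ ^ (t : ℕ)) (fun s : Fin n => if (s : ℕ) = 0 then 1 else 0) := by
  have hs : √(1 - ρ ^ 2) * √((1 - ρ) / (1 + ρ)) = 1 - ρ := by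
    rw [← Real.sqrt_mul (by nlinarith)]
    have : (1 - ρ ^ 2) * ((1 - ρ) / (1 + ρ)) = (1 - ρ) ^ 2 := by field_simp; ring
    rw [this, Real.sqrt_sq (by linarith)]
  ext t s
  simp only [arRoot, shockMatrix, Matrix.of_apply, Matrix.add_apply, Matrix.smul_apply,
    vecMulVec_apply, smul_eq_mul]
  split_ifs with hs0 hst
  · have hg := mul_neg_geom_sum ρ (t : ℕ)
    linear_combination (τ ^ (t : ℕ)) * hg + (τ ^ (t : ℕ)) * (∑ i ∈ Finset.range t, ρ ^ i) * hs
  · ring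
  · ring

theorem surjective_toEuclideanCLM {M : Matrix (Fin n) (Fin n) ℝ} (hM : ∀ t s, t < s → M t s = 0)
    (hdiag : ∀ t, M t t ≠ 0) : Function.Surjective (toEuclideanCLM (𝕜 := ℝ) M) := by
  have hdet : IsUnit M.det := by
    rw [det_of_isLowerTriangular M fun t s h => hM t s h]
    exact (Finset.prod_ne_zero_iff.2 fun t _ => hdiag t).isUnit
  intro y
  refine ⟨toEuclideanCLM (𝕜 := ℝ) M⁻¹ y, ?_⟩
  rw [← mul_apply_eq_comp, ← map_mul, mul_nonsing_inv _ hdet, map_one,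
    one_apply_eq_self]

theorem surjective_arRoot (n : ℕ) (hτ : τ ≠ 0) (hρ : ρ ^ 2 < 1) :
    Function.Surjective (toEuclideanCLM (𝕜 := ℝ) (arRoot n τ ρ)) := by
  refine surjective_toEuclideanCLM (fun t s hts => ?_) fun t => ?_
  · have : (t : ℕ) < s := hts
    rw [arRoot, Matrix.of_apply, if_neg (by omega), if_neg (by omega), mul_zero]
  · have hs : √(1 - ρ ^ 2) ≠ 0 := (Real.sqrt_pos.2 (by linarith)).ne'
    rw [arRoot, Matrix.of_apply]
    refine mul_ne_zero (pow_ne_zero _ hτ) ?_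
    split_ifs with h
    · simp [h]
    · simpa using hs
    · exact absurd le_rfl ‹_›

theorem surjective_shockMatrix (n : ℕ) (hτ : τ ≠ 0) (ρ : ℝ) :
    Function.Surjective (toEuclideanCLM (𝕜 := ℝ) (shockMatrix n τ ρ)) := by
  refine surjective_toEuclideanCLM (fun t s hts => ?_) fun t => ?_
  · have : (t : ℕ) < s := hts
    rw [shockMatrix, Matrix.of_apply, if_neg (by omega), if_neg (by omega), mul_zero]
  · rw [shockMatrix, Matrix.of_apply]
    refine mul_ne_zero (pow_ne_zero _ hτ) ?_
    split_ifs with h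
    · simp [h]
    · simp
    · exact absurd le_rfl ‹_›

theorem continuous_toEuclideanCLM :
    Continuous fun M : Matrix (Fin n) (Fin n) ℝ => toEuclideanCLM (𝕜 := ℝ) M :=
  LinearMap.continuous_of_finiteDimensional
    (toEuclideanCLM (n := Fin n) (𝕜 := ℝ)).toAlgEquiv.toLinearMap

theorem continuous_arRoot (n : ℕ) (τ : ℝ) : Continuous (arRoot n τ) := by
  refine continuous_matrix fun t s => ?_
  simp only [arRoot, Matrix.of_apply]
  split_ifs <;> fun_prop

theorem continuousOn_shockMatrix (n : ℕ) (τ : ℝ) :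
    ContinuousOn (shockMatrix n τ) (Set.Icc 0 1) := by
  have h : ContinuousOn (fun ρ : ℝ => √((1 - ρ) / (1 + ρ))) (Set.Icc 0 1) := by
    refine ContinuousOn.sqrt (ContinuousOn.div (by fun_prop) (by fun_prop) fun ρ hρ => ?_)
    have := hρ.1
    positivity
  refine continuousOn_pi.2 fun t => continuousOn_pi.2 fun s => ?_
  simp only [shockMatrix, Matrix.of_apply]
  split_ifs <;> fun_prop

/-- The operators given by `arRoot` for parameters of absolute value at most `b`. -/
def arRootFamily (n : ℕ) (b : ℝ) : Set (EuclideanSpace ℝ (Fin n) →L[ℝ] EuclideanSpace ℝ (Fin n)) :=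
  ⋃ τ ∈ ({1, -1} : Set ℝ), (fun ρ => toEuclideanCLM (𝕜 := ℝ) (arRoot n τ ρ)) '' Set.Icc 0 b

/-- The operators given by `shockMatrix` for `0 ≤ ρ ≤ 1`. -/
def shockFamily (n : ℕ) : Set (EuclideanSpace ℝ (Fin n) →L[ℝ] EuclideanSpace ℝ (Fin n)) :=
  ⋃ τ ∈ ({1, -1} : Set ℝ), (fun ρ => toEuclideanCLM (𝕜 := ℝ) (shockMatrix n τ ρ)) '' Set.Icc 0 1

theorem isCompact_arRootFamily (n : ℕ) (b : ℝ) : IsCompact (arRootFamily n b) :=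
  (Set.toFinite _).isCompact_biUnion fun τ _ => isCompact_Icc.image
    (continuous_toEuclideanCLM.comp (continuous_arRoot n τ))

theorem isCompact_shockFamily (n : ℕ) : IsCompact (shockFamily n) :=
  (Set.toFinite _).isCompact_biUnion fun τ _ => isCompact_Icc.image_of_continuousOn
    (continuous_toEuclideanCLM.comp_continuousOn (continuousOn_shockMatrix n τ))

theorem surjective_of_mem_arRootFamily {b : ℝ} (hb : b < 1)
    {G : EuclideanSpace ℝ (Fin n) →L[ℝ] EuclideanSpace ℝ (Fin n)} (hG : G ∈ arRootFamily n b) :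
    Function.Surjective G := by
  simp only [arRootFamily, Set.mem_iUnion] at hG
  obtain ⟨τ, hτ, ρ, hρ, rfl⟩ := hG
  refine surjective_arRoot n ?_ ?_
  · rcases hτ with rfl | rfl <;> norm_num
  · have := hρ.1
    have := hρ.2
    nlinarith

theorem surjective_of_mem_shockFamily
    {G : EuclideanSpace ℝ (Fin n) →L[ℝ] EuclideanSpace ℝ (Fin n)} (hG : G ∈ shockFamily n) :
    Function.Surjective G := by
  simp only [shockFamily, Set.mem_iUnion] at hG
  obtain ⟨τ, hτ, ρ, hρ, rfl⟩ := hG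
  refine surjective_shockMatrix n ?_ ρ
  rcases hτ with rfl | rfl <;> norm_num

theorem exists_sign_mul_abs (ρ : ℝ) : ∃ τ ∈ ({1, -1} : Set ℝ), τ * |ρ| = ρ := by
  rcases abs_choice ρ with h | h
  · exact ⟨1, by simp, by rw [h, one_mul]⟩
  · exact ⟨-1, by simp, by rw [h]; ring⟩

theorem ar1Law_eq_map (μ : EuclideanSpace ℝ (Fin n)) (σ : ℝ) (hτ : τ ^ 2 = 1) (hρ : ρ ^ 2 ≤ 1) :
    ar1Law μ σ (τ * ρ) = (stdGaussian (EuclideanSpace ℝ (Fin n))).map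
      (fun z => μ + σ • toEuclideanCLM (𝕜 := ℝ) (arRoot n τ ρ) z) := by
  have h : σ ^ 2 • ar1Corr n (τ * ρ) = (σ • arRoot n τ ρ) * (σ • arRoot n τ ρ)ᵀ := by
    rw [← arRoot_mul_transpose n hτ hρ, transpose_smul, Matrix.smul_mul, Matrix.mul_smul, smul_smul,
      sq]
  rw [ar1Law, h, multivariateGaussian_mul_transpose]
  simp

end AutoRegression

/-! ### Reduction of rejection probabilities to the standard Gaussian. -/

section RejectionProbability

variable {n k q : ℕ} {w : ℤ → ℝ} {X : Matrix (Fin n) (Fin k) ℝ} {R : Matrix (Fin q) (Fin k) ℝ}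

local notation "𝔼" => EuclideanSpace ℝ (Fin n)

theorem ar1Law_rejRegion (hn : n ≠ 0) (hX : X.rank = k) (r : Fin q → ℝ) (β : Fin k → ℝ)
    {σ : ℝ} (hσ : σ ≠ 0) {τ ρ : ℝ} (hτ : τ ^ 2 = 1) (hρ : ρ ^ 2 ≤ 1) (C : ℝ) :
    ar1Law (WithLp.toLp 2 (X *ᵥ β)) σ (τ * ρ) (rejRegion w X R r C)
      = stdGaussian 𝔼 {z | C ≤ testStat w X R (σ⁻¹ • (r - R *ᵥ β))
          (toEuclideanCLM (𝕜 := ℝ) (arRoot n τ ρ) z)} := by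
  have hmeas : MeasurableSet (rejRegion w X R r C) :=
    measurableSet_le measurable_const (measurable_testStat w R hn X r)
  rw [ar1Law_eq_map _ _ hτ hρ, Measure.map_apply (by fun_prop) hmeas]
  refine congrArg (stdGaussian 𝔼) (Set.ext fun z => ?_)
  have hT := testStat_toLp_mulVec_add_smul w R hn hX r β hσ
    (toEuclideanCLM (𝕜 := ℝ) (arRoot n τ ρ) z)
  rw [Set.mem_preimage, rejRegion, Set.mem_ofPred_eq, Set.mem_ofPred_eq, hT]

theorem exists_ar1Law_rejRegion_eq (hn : n ≠ 0) (hX : X.rank = k) (r : Fin q → ℝ)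
    (β : Fin k → ℝ) {σ : ℝ} (hσ : σ ≠ 0) {b ρ : ℝ} (hρb : |ρ| ≤ b) (hb : b ≤ 1) (C : ℝ) :
    ∃ G ∈ arRootFamily n b, ar1Law (WithLp.toLp 2 (X *ᵥ β)) σ ρ (rejRegion w X R r C)
      = stdGaussian 𝔼 {z | C ≤ testStat w X R (σ⁻¹ • (r - R *ᵥ β)) (G z)} := by
  obtain ⟨τ, hτ, hτρ⟩ := exists_sign_mul_abs ρ
  refine ⟨toEuclideanCLM (𝕜 := ℝ) (arRoot n τ |ρ|), ?_, ?_⟩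
  · simp only [arRootFamily, Set.mem_iUnion]
    exact ⟨τ, hτ, |ρ|, ⟨abs_nonneg ρ, hρb⟩, rfl⟩
  · have hτ2 : τ ^ 2 = 1 := by rcases hτ with rfl | rfl <;> norm_num
    have hρ2 : |ρ| ^ 2 ≤ 1 := pow_le_one₀ (abs_nonneg ρ) (hρb.trans hb)
    rw [← ar1Law_rejRegion hn hX r β hσ hτ2 hρ2 C, hτρ]

theorem exists_signVector_eq (hX : X.rank = k) (hp : ePlus n ∈ meanSpace X)
    (hm : eMinus n ∈ meanSpace X) (hRp : R *ᵥ betaHat X (ePlus n) = 0)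
    (hRm : R *ᵥ betaHat X (eMinus n) = 0) {τ : ℝ} (hτ : τ ∈ ({1, -1} : Set ℝ)) :
    ∃ β : Fin k → ℝ, signVector n τ = WithLp.toLp 2 (X *ᵥ β) ∧ R *ᵥ β = 0 := by
  rcases hτ with rfl | rfl
  · obtain ⟨β, hβ⟩ := hp
    refine ⟨β, ?_, ?_⟩
    · rw [← hβ]
      simp [signVector, ePlus]
    · rwa [hβ, betaHat_toLp_mulVec hX] at hRp
  · obtain ⟨β, hβ⟩ := hm
    -- `e₋` starts with `-1`, whereas `(-1) ^ t` starts with `1`.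
    refine ⟨-β, ?_, ?_⟩
    · rw [mulVec_neg, WithLp.toLp_neg, ← hβ]
      ext i
      simp [signVector, eMinus, pow_succ]
    · rw [hβ, betaHat_toLp_mulVec hX] at hRm
      rw [mulVec_neg, hRm, neg_zero]

/-- Under the conditions on `e₊` and `e₋` the degenerate direction of the process drops out. -/
theorem exists_ar1Law_rejRegion_eq_shock (hn : n ≠ 0) (hX : X.rank = k) (hp : ePlus n ∈ meanSpace X)
    (hm : eMinus n ∈ meanSpace X) (hRp : R *ᵥ betaHat X (ePlus n) = 0)
    (hRm : R *ᵥ betaHat X (eMinus n) = 0) (r : Fin q → ℝ) (β : Fin k → ℝ) {σ : ℝ} (hσ : σ ≠ 0)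
    {ρ : ℝ} (hρ : ρ ∈ Set.Ioo (-1 : ℝ) 1) (C : ℝ) :
    ∃ G ∈ shockFamily n, ar1Law (WithLp.toLp 2 (X *ᵥ β)) σ ρ (rejRegion w X R r C)
      = stdGaussian 𝔼 {z | C ≤ testStat w X R ((σ * √(1 - ρ ^ 2))⁻¹ • (r - R *ᵥ β)) (G z)} := by
  obtain ⟨τ, hτ, hτρ⟩ := exists_sign_mul_abs ρ
  have hρ1 : |ρ| < 1 := abs_lt.2 hρ
  have hρ2 : |ρ| ^ 2 < 1 := pow_lt_one₀ (abs_nonneg ρ) hρ1 two_ne_zero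
  refine ⟨toEuclideanCLM (𝕜 := ℝ) (shockMatrix n τ |ρ|), ?_, ?_⟩
  · simp only [shockFamily, Set.mem_iUnion]
    exact ⟨τ, hτ, |ρ|, ⟨abs_nonneg ρ, hρ1.le⟩, rfl⟩
  · have hτ2 : τ ^ 2 = 1 := by rcases hτ with rfl | rfl <;> norm_num
    obtain ⟨b, hb, hRb⟩ := exists_signVector_eq hX hp hm hRp hRm hτ
    have hs : √(1 - ρ ^ 2) ≠ 0 := (Real.sqrt_pos.2 (by rw [sq_abs] at hρ2; linarith)).ne'
    conv_lhs => rw [← hτρ]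
    rw [ar1Law_rejRegion hn hX r β hσ hτ2 hρ2.le C]
    refine congrArg (stdGaussian 𝔼) (Set.ext fun z => ?_)
    rw [Set.mem_ofPred_eq, Set.mem_ofPred_eq]
    obtain ⟨a, ha⟩ : ∃ a : ℝ, toEuclideanCLM (𝕜 := ℝ) (arRoot n τ |ρ|) z
        = WithLp.toLp 2 (X *ᵥ (a • b)) +
          √(1 - ρ ^ 2) • toEuclideanCLM (𝕜 := ℝ) (shockMatrix n τ |ρ|) z := by
      -- The rank-one part of the root only sees the first coordinate of `z`.
      refine ⟨(1 - √(1 - ρ ^ 2)) * ((fun s : Fin n => if (s : ℕ) = 0 then 1 else 0) ⬝ᵥ z.ofLp), ?_⟩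
      rw [mulVec_smul, WithLp.toLp_smul, ← hb, arRoot_eq_add n τ (abs_nonneg ρ) hρ1, sq_abs]
      ext i
      simp only [map_add, map_smul, _root_.add_apply, _root_.smul_apply,
        PiLp.add_apply, PiLp.smul_apply, ofLp_toEuclideanCLM, vecMulVec_mulVec, signVector]
      simp only [smul_eq_mul, Pi.smul_apply, MulOpposite.smul_eq_mul_unop, MulOpposite.unop_op]
      ring
    have hT := testStat_toLp_mulVec_add_smul w R hn hX (σ⁻¹ • (r - R *ᵥ β)) (a • b) hs
      (toEuclideanCLM (𝕜 := ℝ) (shockMatrix n τ |ρ|) z)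
    rw [← ha, mulVec_smul, hRb, smul_zero, sub_zero, smul_smul, ← _root_.mul_inv_rev] at hT
    rw [hT]

end RejectionProbability

/-! ### Distance to the null hypothesis against the size of `r - R β`. -/

section Distance

variable {n k q : ℕ} {X : Matrix (Fin n) (Fin k) ℝ} {R : Matrix (Fin q) (Fin k) ℝ}

instance isProbabilityMeasure_ar1Law (μ : EuclideanSpace ℝ (Fin n)) (σ ρ : ℝ) :
    IsProbabilityMeasure (ar1Law μ σ ρ) := by
  unfold ar1Law
  infer_instance

/-- Adding `S (r - R β)` to `β`, with `S` a right inverse of `R`, reaches the null at a cost linear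
in `r - R β`. -/
theorem exists_infDist_nullMeans_le (X : Matrix (Fin n) (Fin k) ℝ) (hR : R.rank = q)
    (r : Fin q → ℝ) :
    ∃ κ : ℝ, 0 < κ ∧ ∀ β : Fin k → ℝ,
      Metric.infDist (WithLp.toLp 2 (X *ᵥ β)) (nullMeans X R r) ≤ κ * ‖r - R *ᵥ β‖ := by
  obtain ⟨S, hS⟩ := exists_rightInverse_of_rank_eq hR
  let L : (Fin q → ℝ) →L[ℝ] EuclideanSpace ℝ (Fin n) := LinearMap.toContinuousLinearMap
    ((WithLp.linearEquiv 2 ℝ (Fin n → ℝ)).symm.toLinearMap ∘ₗ (X * S).mulVecLin)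
  have hL : ∀ v, L v = WithLp.toLp 2 ((X * S) *ᵥ v) := fun v => rfl
  refine ⟨‖L‖ + 1, by positivity, fun β => ?_⟩
  have hmem : WithLp.toLp 2 (X *ᵥ (β + S *ᵥ (r - R *ᵥ β))) ∈ nullMeans X R r := by
    refine ⟨_, rfl, ?_⟩
    rw [mulVec_add, mulVec_mulVec, hS, one_mulVec, add_sub_cancel]
  calc _ ≤ _ := Metric.infDist_le_dist_of_mem hmem
    _ = ‖L (r - R *ᵥ β)‖ := by
        rw [hL, dist_comm, dist_eq_norm, mulVec_add, WithLp.toLp_add, add_sub_cancel_left,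
          mulVec_mulVec]
    _ ≤ ‖L‖ * ‖r - R *ᵥ β‖ := L.le_opNorm _
    _ ≤ _ := by gcongr; linarith

/-- Ensures that the infima defining the power run over nonempty sets; an empty one would be `∞` and
could not converge to one. -/
theorem exists_altMeans_le_infDist (hq : 1 ≤ q) (hX : X.rank = k) (hR : R.rank = q)
    (r : Fin q → ℝ) (D : ℝ) :
    ∃ μ ∈ altMeans X R r, D ≤ Metric.infDist μ (nullMeans X R r) := by
  obtain ⟨S, hS⟩ := exists_rightInverse_of_rank_eq hR
  let L : EuclideanSpace ℝ (Fin n) →L[ℝ] (Fin q → ℝ) := LinearMap.toContinuousLinearMap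
    { toFun := fun y => R *ᵥ betaHat X y
      map_add' := fun a b => by rw [betaHat_add, mulVec_add]
      map_smul' := fun c a => by rw [betaHat_smul, mulVec_smul, RingHom.id_apply] }
  have hL : ∀ β, L (WithLp.toLp 2 (X *ᵥ β)) = R *ᵥ β := fun β =>
    congrArg (R *ᵥ ·) (betaHat_toLp_mulVec hX β)
  -- Since `y ↦ R β̂(y)` is Lipschitz with constant `‖L‖`, a gap `t` in `R β` forces distance at
  -- least `|D| + 1`; the extra `1` also excludes membership in the null.
  set t := (‖L‖ + 1) * (|D| + 1) with ht
  have ht0 : 0 < t := by positivity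
  have hRβ : R *ᵥ (S *ᵥ (r + fun _ => t)) = r + fun _ => t := by
    rw [mulVec_mulVec, hS, one_mulVec]
  have hne : Nonempty (Fin q) := ⟨⟨0, hq⟩⟩
  have hdist : ∀ μ₀ ∈ nullMeans X R r,
      |D| + 1 ≤ dist (WithLp.toLp 2 (X *ᵥ (S *ᵥ (r + fun _ => t)))) μ₀ := by
    rintro _ ⟨β₀, rfl, h₀⟩
    have h := L.le_opNorm (WithLp.toLp 2 (X *ᵥ (S *ᵥ (r + fun _ => t))) - WithLp.toLp 2 (X *ᵥ β₀))
    rw [map_sub, hL, hL, hRβ, h₀, add_sub_cancel_left, pi_norm_const, Real.norm_eq_abs,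
      abs_of_pos ht0, ← dist_eq_norm] at h
    have hd := dist_nonneg (x := WithLp.toLp 2 (X *ᵥ (S *ᵥ (r + fun _ => t))))
      (y := WithLp.toLp 2 (X *ᵥ β₀))
    have hL0 : 0 < ‖L‖ + 1 := by positivity
    refine le_of_mul_le_mul_left (h.trans ?_) hL0
    linarith
  refine ⟨WithLp.toLp 2 (X *ᵥ (S *ᵥ (r + fun _ => t))), ⟨⟨_, rfl⟩, fun hmem => ?_⟩, ?_⟩
  · have := hdist _ hmem
    rw [dist_self] at this
    linarith [abs_nonneg D]
  · have hnonempty : (nullMeans X R r).Nonempty :=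
      ⟨_, S *ᵥ r, rfl, by rw [mulVec_mulVec, hS, one_mulVec]⟩
    refine (Metric.le_infDist hnonempty).2 fun μ₀ hμ₀ => ?_
    linarith [hdist μ₀ hμ₀, le_abs_self D]

theorem tendsto_one_of_eventually_sub_le {f : ℕ → ℝ≥0∞} (h1 : ∀ m, f m ≤ 1)
    (h : ∀ δ : ℝ≥0∞, δ ≠ 0 → ∀ᶠ m in atTop, 1 - δ ≤ f m) : Tendsto f atTop (𝓝 1) := by
  refine (ENNReal.tendsto_nhds ENNReal.one_ne_top).2 fun δ hδ => ?_
  filter_upwards [h δ hδ.ne'] with m hm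
  exact ⟨hm, (h1 m).trans le_self_add⟩

end Distance

/-! ### The claims on size and power. -/

section Assembly

variable {n k q : ℕ} {X : Matrix (Fin n) (Fin k) ℝ} {R : Matrix (Fin q) (Fin k) ℝ} {w : ℤ → ℝ}

theorem tendsto_power_of_ratio_tendsto (hn : n ≠ 0) (hq : 1 ≤ q) (hX : X.rank = k)
    (hR : R.rank = q) (r : Fin q → ℝ) (hw : AdmissibleWeights n w) (hXR : DesignCondition X R)
    {C : ℝ} (hC : 0 < C) {ε : ℝ} (hε : 0 < ε) (hε1 : ε < 1) {c σ : ℕ → ℝ} (hσ : ∀ m, 0 < σ m)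
    (hcσ : Tendsto (fun m => c m / σ m) atTop atTop) :
    Tendsto (fun m => ⨅ μ ∈ altMeans X R r, ⨅ (_ : c m ≤ Metric.infDist μ (nullMeans X R r)),
      ⨅ ρ ∈ Set.Icc (-1 + ε) (1 - ε), ar1Law μ (σ m) ρ (rejRegion w X R r C)) atTop (𝓝 1) := by
  refine tendsto_one_of_eventually_sub_le (fun m => ?_) fun δ hδ => ?_
  · obtain ⟨μ, hμ, hd⟩ := exists_altMeans_le_infDist hq hX hR r (c m)
    exact (iInf₂_le_of_le μ hμ (iInf_le_of_le hd
      (iInf₂_le (0 : ℝ) ⟨by linarith, by linarith⟩))).trans prob_le_one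
  · obtain ⟨κ, hκ, hdist⟩ := exists_infDist_nullMeans_le X hR r
    obtain ⟨N, hN⟩ := exists_le_power_of_norm_ge hn hX hw hXR (isCompact_arRootFamily n (1 - ε))
      (fun G hG => surjective_of_mem_arRootFamily (by linarith) hG) hC hδ
    filter_upwards [hcσ.eventually_ge_atTop (N * κ)] with m hm
    refine le_iInf₂ fun μ hμ => le_iInf fun hd => le_iInf₂ fun ρ hρ => ?_
    obtain ⟨β, rfl⟩ := hμ.1
    obtain ⟨G, hG, h⟩ := exists_ar1Law_rejRegion_eq (w := w) (R := R) hn hX r β (hσ m).ne'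
      (b := 1 - ε) (abs_le.2 ⟨by linarith [hρ.1], hρ.2⟩) (by linarith) C
    rw [h]
    refine hN _ ?_ G hG
    rw [norm_smul, norm_inv, Real.norm_eq_abs, abs_of_pos (hσ m), inv_mul_eq_div,
      le_div_iff₀ (hσ m)]
    rw [le_div_iff₀ (hσ m)] at hm
    have := hdist β
    nlinarith

variable (hp : ePlus n ∈ meanSpace X) (hm : eMinus n ∈ meanSpace X)
  (hRp : R *ᵥ betaHat X (ePlus n) = 0) (hRm : R *ᵥ betaHat X (eMinus n) = 0)

include hp hm hRp hRm

theorem exists_ar1Law_rejRegion_eq_null (hn : n ≠ 0) (hX : X.rank = k) (r : Fin q → ℝ)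
    {μ : EuclideanSpace ℝ (Fin n)} (hμ : μ ∈ nullMeans X R r) {σ : ℝ} (hσ : σ ≠ 0) {ρ : ℝ}
    (hρ : ρ ∈ Set.Ioo (-1 : ℝ) 1) (C : ℝ) :
    ∃ G ∈ shockFamily n, ar1Law μ σ ρ (rejRegion w X R r C)
      = stdGaussian (EuclideanSpace ℝ (Fin n)) {z | C ≤ testStat w X R 0 (G z)} := by
  obtain ⟨β, rfl, hβ⟩ := hμ
  obtain ⟨G, hG, h⟩ := exists_ar1Law_rejRegion_eq_shock (w := w) hn hX hp hm hRp hRm r β hσ hρ C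
  refine ⟨G, hG, ?_⟩
  rw [h, hβ, sub_self, smul_zero]

theorem size_lt_one (hn : n ≠ 0) (hX : X.rank = k) (r : Fin q → ℝ) (hw : AdmissibleWeights n w)
    (hXR : DesignCondition X R) {C : ℝ} (hC : 0 < C) :
    (⨆ μ ∈ nullMeans X R r, ⨆ σ ∈ Set.Ioi (0 : ℝ), ⨆ ρ ∈ Set.Ioo (-1 : ℝ) 1,
      ar1Law μ σ ρ (rejRegion w X R r C)) < 1 := by
  obtain ⟨η, hη, h⟩ := exists_size_le_one_sub hn hX hw hXR (isCompact_shockFamily n)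
    (fun G hG => surjective_of_mem_shockFamily hG) hC
  refine lt_of_le_of_lt ?_ (ENNReal.sub_lt_self ENNReal.one_ne_top one_ne_zero hη.ne')
  refine iSup₂_le fun μ hμ => iSup₂_le fun σ hσ => iSup₂_le fun ρ hρ => ?_
  obtain ⟨G, hG, hG'⟩ := exists_ar1Law_rejRegion_eq_null (w := w) hp hm hRp hRm hn hX r hμ
    (ne_of_gt hσ) hρ C
  exact hG'.trans_le (h G hG)

theorem null_rejection_pos (hn : n ≠ 0) (hq : 1 ≤ q) (hX : X.rank = k) (hR : R.rank = q)
    (r : Fin q → ℝ) (hw : AdmissibleWeights n w) (hXR : DesignCondition X R) {C : ℝ}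
    (hC : 0 < C) :
    0 < ⨅ μ ∈ nullMeans X R r, ⨅ σ ∈ Set.Ioi (0 : ℝ), ⨅ ρ ∈ Set.Ioo (-1 : ℝ) 1,
      ar1Law μ σ ρ (rejRegion w X R r C) := by
  obtain ⟨η, hη, h⟩ := exists_le_null_rejection hn hq hX hR hw hXR (isCompact_shockFamily n)
    (fun G hG => surjective_of_mem_shockFamily hG) hC
  refine hη.trans_le (le_iInf₂ fun μ hμ => le_iInf₂ fun σ hσ => le_iInf₂ fun ρ hρ => ?_)
  obtain ⟨G, hG, hG'⟩ := exists_ar1Law_rejRegion_eq_null (w := w) hp hm hRp hRm hn hX r hμ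
    (ne_of_gt hσ) hρ C
  exact (h G hG).trans_eq hG'.symm

theorem power_pos (hn : n ≠ 0) (hq : 1 ≤ q) (hX : X.rank = k) (hR : R.rank = q)
    (r : Fin q → ℝ) (hw : AdmissibleWeights n w) (hXR : DesignCondition X R) {C : ℝ}
    (hC : 0 < C) :
    0 < ⨅ μ ∈ altMeans X R r, ⨅ σ ∈ Set.Ioi (0 : ℝ), ⨅ ρ ∈ Set.Ioo (-1 : ℝ) 1,
      ar1Law μ σ ρ (rejRegion w X R r C) := by
  obtain ⟨η, hη, h⟩ := exists_le_null_rejection hn hq hX hR hw hXR (isCompact_shockFamily n)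
    (fun G hG => surjective_of_mem_shockFamily hG) hC
  refine (ENNReal.half_pos hη.ne').trans_le
    (le_iInf₂ fun μ hμ => le_iInf₂ fun σ hσ => le_iInf₂ fun ρ hρ => ?_)
  obtain ⟨β, rfl⟩ := hμ.1
  obtain ⟨G, hG, hG'⟩ := exists_ar1Law_rejRegion_eq_shock (w := w) hn hX hp hm hRp hRm r β
    (ne_of_gt hσ) hρ C
  rw [hG']
  exact (ENNReal.div_le_div_right (h G hG) 2).trans
    (half_null_rejection_le hn hX hw hXR (surjective_of_mem_shockFamily hG) C _)

theorem tendsto_power_of_abs_tendsto (hn : n ≠ 0) (hq : 1 ≤ q) (hX : X.rank = k)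
    (hR : R.rank = q) (r : Fin q → ℝ) (hw : AdmissibleWeights n w) (hXR : DesignCondition X R)
    {C : ℝ} (hC : 0 < C) {c : ℝ} (hc : 0 < c) {ρ : ℕ → ℝ} (hρ : ∀ m, ρ m ∈ Set.Ioo (-1 : ℝ) 1)
    (hρ1 : Tendsto (fun m => |ρ m|) atTop (𝓝 1)) :
    Tendsto (fun m => ⨅ μ ∈ altMeans X R r, ⨅ σ ∈ Set.Ioi (0 : ℝ),
      ⨅ (_ : c ≤ Metric.infDist μ (nullMeans X R r) / σ),
        ar1Law μ σ (ρ m) (rejRegion w X R r C)) atTop (𝓝 1) := by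
  refine tendsto_one_of_eventually_sub_le (fun m => ?_) fun δ hδ => ?_
  · obtain ⟨μ, hμ, hd⟩ := exists_altMeans_le_infDist hq hX hR r c
    exact (iInf₂_le_of_le μ hμ (iInf₂_le_of_le (1 : ℝ) (Set.mem_Ioi.2 one_pos)
      (iInf_le _ (by rwa [div_one])))).trans prob_le_one
  · obtain ⟨κ, hκ, hdist⟩ := exists_infDist_nullMeans_le X hR r
    obtain ⟨N, hN⟩ := exists_le_power_of_norm_ge hn hX hw hXR (isCompact_shockFamily n)
      (fun G hG => surjective_of_mem_shockFamily hG) hC hδ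
    -- Once this is below `c`, a standardized distance of at least `c` forces `‖r'‖ ≥ N` for the
    -- rescaled deviation, for all `μ` and `σ` at once.
    have hs : Tendsto (fun m => N * κ * √(1 - ρ m ^ 2)) atTop (𝓝 0) := by
      have h : Tendsto (fun m => N * κ * √(1 - |ρ m| ^ 2)) atTop (𝓝 (N * κ * √(1 - 1 ^ 2))) :=
        ((hρ1.pow 2).const_sub 1).sqrt.const_mul _
      simpa using h
    filter_upwards [hs.eventually_lt_const hc] with m hm
    refine le_iInf₂ fun μ hμ => le_iInf₂ fun σ hσ => le_iInf fun hd => ?_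
    have hσ0 : 0 < σ := hσ
    have hs0 : 0 < √(1 - ρ m ^ 2) := by
      have := (sq_lt_one_iff_abs_lt_one (ρ m)).2 (abs_lt.2 (hρ m))
      exact Real.sqrt_pos.2 (by linarith)
    obtain ⟨β, rfl⟩ := hμ.1
    obtain ⟨G, hG, h⟩ := exists_ar1Law_rejRegion_eq_shock (w := w) hn hX hp ‹_› hRp hRm r β
      hσ0.ne' (hρ m) C
    rw [h]
    refine hN _ ?_ G hG
    have hσs := mul_pos hσ0 hs0
    rw [norm_smul, norm_inv, Real.norm_eq_abs, abs_of_pos hσs, inv_mul_eq_div, le_div_iff₀ hσs]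
    rw [le_div_iff₀ hσ0] at hd
    refine le_of_mul_le_mul_left (le_trans ?_ (hd.trans (hdist β))) hκ
    calc κ * (N * (σ * √(1 - ρ m ^ 2))) = N * κ * √(1 - ρ m ^ 2) * σ := by ring
      _ ≤ c * σ := by gcongr

theorem exists_size_control (hn : n ≠ 0) (hX : X.rank = k) (r : Fin q → ℝ)
    (hw : AdmissibleWeights n w) (hXR : DesignCondition X R) {δ : ℝ≥0∞} (hδ : δ ≠ 0) :
    ∃ C : ℝ, 0 < C ∧
      (⨆ μ ∈ nullMeans X R r, ⨆ σ ∈ Set.Ioi (0 : ℝ), ⨆ ρ ∈ Set.Ioo (-1 : ℝ) 1,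
        ar1Law μ σ ρ (rejRegion w X R r C)) ≤ δ := by
  obtain ⟨C, hC, h⟩ := exists_size_le hn hX hw hXR (isCompact_shockFamily n)
    (fun G hG => surjective_of_mem_shockFamily hG) hδ
  refine ⟨C, hC, iSup₂_le fun μ hμ => iSup₂_le fun σ hσ => iSup₂_le fun ρ hρ => ?_⟩
  obtain ⟨G, hG, hG'⟩ := exists_ar1Law_rejRegion_eq_null (w := w) hp hm hRp hRm hn hX r hμ
    (ne_of_gt hσ) hρ C
  exact hG'.trans_le (h G hG)

end Assembly

end HACTest

theorem theorem3p4 (n k q : ℕ) (hk : 1 ≤ k) (hkn : k < n) (hq : 1 ≤ q)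
    (X : Matrix (Fin n) (Fin k) ℝ) (hX : X.rank = k)
    (R : Matrix (Fin q) (Fin k) ℝ) (hR : R.rank = q) (r : Fin q → ℝ)
    (w : ℤ → ℝ) (hw : HACTest.AdmissibleWeights n w)
    (hXR : HACTest.DesignCondition X R) :
    -- power under growing standardized distance from the null; no condition on `e₊`, `e₋`
    (∀ C : ℝ, 0 < C → ∀ ε : ℝ, 0 < ε → ε < 1 →
      ∀ c σ : ℕ → ℝ, (∀ m, 0 < c m) → (∀ m, 0 < σ m) →
      Tendsto (fun m => c m / σ m) atTop atTop →
      Tendsto (fun m => ⨅ μ ∈ HACTest.altMeans X R r,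
          ⨅ (_ : c m ≤ Metric.infDist μ (HACTest.nullMeans X R r)),
          ⨅ ρ ∈ Set.Icc (-1 + ε) (1 - ε),
            HACTest.ar1Law μ (σ m) ρ (HACTest.rejRegion w X R r C)) atTop (𝓝 1)) ∧
    (HACTest.ePlus n ∈ HACTest.meanSpace X → HACTest.eMinus n ∈ HACTest.meanSpace X →
      R *ᵥ HACTest.betaHat X (HACTest.ePlus n) = 0 →
      R *ᵥ HACTest.betaHat X (HACTest.eMinus n) = 0 →
      (∀ C : ℝ, 0 < C →
        -- the size is less than one
        (⨆ μ ∈ HACTest.nullMeans X R r, ⨆ σ ∈ Set.Ioi (0 : ℝ), ⨆ ρ ∈ Set.Ioo (-1 : ℝ) 1,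
          HACTest.ar1Law μ σ ρ (HACTest.rejRegion w X R r C)) < 1 ∧
        -- the null rejection probabilities are bounded away from zero
        0 < (⨅ μ ∈ HACTest.nullMeans X R r, ⨅ σ ∈ Set.Ioi (0 : ℝ), ⨅ ρ ∈ Set.Ioo (-1 : ℝ) 1,
          HACTest.ar1Law μ σ ρ (HACTest.rejRegion w X R r C)) ∧
        -- the infimal power is bounded away from zero
        0 < (⨅ μ ∈ HACTest.altMeans X R r, ⨅ σ ∈ Set.Ioi (0 : ℝ), ⨅ ρ ∈ Set.Ioo (-1 : ℝ) 1,
          HACTest.ar1Law μ σ ρ (HACTest.rejRegion w X R r C)) ∧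
        -- the power tends to one as `|ρ| → 1`
        (∀ c : ℝ, 0 < c → ∀ ρ : ℕ → ℝ, (∀ m, ρ m ∈ Set.Ioo (-1 : ℝ) 1) →
          Tendsto (fun m => |ρ m|) atTop (𝓝 1) →
          Tendsto (fun m => ⨅ μ ∈ HACTest.altMeans X R r, ⨅ σ ∈ Set.Ioi (0 : ℝ),
            ⨅ (_ : c ≤ Metric.infDist μ (HACTest.nullMeans X R r) / σ),
              HACTest.ar1Law μ σ (ρ m) (HACTest.rejRegion w X R r C)) atTop (𝓝 1))) ∧
      -- the size can be controlled
      (∀ δ : ℝ, 0 < δ → δ < 1 → ∃ C : ℝ, 0 < C ∧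
        (⨆ μ ∈ HACTest.nullMeans X R r, ⨆ σ ∈ Set.Ioi (0 : ℝ), ⨆ ρ ∈ Set.Ioo (-1 : ℝ) 1,
          HACTest.ar1Law μ σ ρ (HACTest.rejRegion w X R r C)) ≤ ENNReal.ofReal δ)) := by
  have hn : n ≠ 0 := by omega
  refine ⟨fun C hC ε hε hε1 c σ _ hσ hcσ =>
    HACTest.tendsto_power_of_ratio_tendsto hn hq hX hR r hw hXR hC hε hε1 hσ hcσ,
    fun hp hm hRp hRm => ⟨fun C hC => ⟨?_, ?_, ?_, fun c hc ρ hρ hρ1 => ?_⟩, fun δ hδ _ => ?_⟩⟩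
  · exact HACTest.size_lt_one hp hm hRp hRm hn hX r hw hXR hC
  · exact HACTest.null_rejection_pos hp hm hRp hRm hn hq hX hR r hw hXR hC
  · exact HACTest.power_pos hp hm hRp hRm hn hq hX hR r hw hXR hC
  · exact HACTest.tendsto_power_of_abs_tendsto hp hm hRp hRm hn hq hX hR r hw hXR hC hc hρ hρ1
  · exact HACTest.exists_size_control hp hm hRp hRm hn hX r hw hXR
      (ENNReal.ofReal_pos.2 hδ).ne'
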